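/- Let $G=(V,E)$ be a connected, finite or countably infinite, simple undirected graph in which every vertex has finite degree (the degrees need not be bounded). Let $L_2(G)$ be the Hilbert space of all $f:V\to\mathbb{C}$ with $\sum_{v\in V}|f(v)|^2<\infty$, and let $L$ be the Laplace operator $Lf(v)=\sum_{u\sim v}(f(v)-f(u))$ on the domain $\{f\in L_2(G): Lf\in L_2(G)\}$. A spectral Fourier transform of $L$ is a unitary operator $\mathcal{F}_L$ from $L_2(G)$ onto a direct integral of Hilbert spaces $A=\int_{[0,\infty)}A(\lambda)\,dm(\lambda)$, with $m$ a $\sigma$-finite Borel measure on $[0,\infty)$, that maps the domain of $L$ onto $\{a\in A:\lambda a(\lambda)\in A\}$ and satisfies $\mathcal{F}_L(Lf)=\lambda\,\mathcal{F}_Lf$ for all $f$ in the domain of $L$. Given such an $\mathcal{F}_L$, let $e^{itL}f$ ($t\in\mathbb{R}$, $f\in L_2(G)$) be the vector with $\mathcal{F}_L(e^{itL}f)(\lambda)=e^{it\lambda}\,\mathcal{F}_Lf(\lambda)$ for $m$-almost every $\lambda$, and let the Paley–Wiener space $PW_\omega(L)$ be the set of all $f\in L_2(G)$ whose transform $\mathcal{F}_Lf$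 has support in $[0,\omega]$, that is, vanishes $m$-almost everywhere outside $[0,\omega]$. **Theorem.** The operator $L$ has a spectral Fourier transform, and for every spectral Fourier transform $\mathcal{F}_L$ of $L$ the following holds. Let $\omega\ge 0$ and let $h:\mathbb{C}\to\mathbb{C}$ be an entire function of exponential type $\omega$ (for every $\varepsilon>0$ there is a constant $C$ with $|h(z)|\le Ce^{(\omega+\varepsilon)|z|}$ for all $z\in\mathbb{C}$) whose restriction to $\mathbb{R}$ belongs to $L_1(\mathbb{R})$. Then for every $f\in L_2(G)$ the function $t\mapsto h(t)e^{itL}f$ is Bochner integrable on $\mathbb{R}$, and the vector $$\mathcal{Q}_h^\omega(f)=\int_{-\infty}^{\infty}h(t)\,e^{itL}f\,dt$$ belongs to $PW_\omega(L)$. -/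

import Mathlib

open MeasureTheory
open scoped NNReal ENNReal InnerProductSpace

noncomputable section

/-- `h` is an entire function of exponential type (at most) `ω`. -/
def IsEntireOfExpType (ω : ℝ) (h : ℂ → ℂ) : Prop :=
  Differentiable ℂ h ∧
    ∀ ε : ℝ, 0 < ε → ∃ C : ℝ, ∀ z : ℂ, ‖h z‖ ≤ C * Real.exp ((ω + ε) * ‖z‖)

/-- The Hilbert space of square-summable complex functions on the vertices. -/
abbrev GraphL2 (V : Type*) : Type _ := lp (fun _ : V => ℂ) 2

/-- The pointwise Laplacian `D - A` on arbitrary functions on the vertices. -/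
def lapFun {V : Type*} (G : SimpleGraph V) [G.LocallyFinite] (f : V → ℂ) (v : V) : ℂ :=
  ∑ u ∈ G.neighborFinset v, (f v - f u)

theorem lapFun_add {V : Type*} (G : SimpleGraph V) [G.LocallyFinite] (f g : V → ℂ) :
    lapFun G (f + g) = lapFun G f + lapFun G g := by
  funext v
  simp only [lapFun, Pi.add_apply, ← Finset.sum_add_distrib]
  exact Finset.sum_congr rfl fun u _ => by ring

theorem lapFun_smul {V : Type*} (G : SimpleGraph V) [G.LocallyFinite] (c : ℂ) (f : V → ℂ) :
    lapFun G (c • f) = c • lapFun G f := by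
  funext v
  simp only [lapFun, Pi.smul_apply, smul_eq_mul, Finset.mul_sum]
  exact Finset.sum_congr rfl fun u _ => by ring

/-- The (possibly unbounded) Laplace operator `L = D - A` in the space of square-summable functions,
on its natural domain: all square-summable `f` for which `L f` is square-summable. -/
def laplacian {V : Type*} (G : SimpleGraph V) [G.LocallyFinite] :
    GraphL2 V →ₗ.[ℂ] GraphL2 V where
  domain :=
    { carrier := {f | Memℓp (lapFun G f) 2}
      zero_mem' := by
        have h : lapFun G ((0 : GraphL2 V) : V → ℂ) = 0 := by
          funext v
          simp [lapFun]
        simp only [Set.mem_ofPred_eq, h]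
        exact zero_memℓp
      add_mem' := by
        intro f g hf hg
        simp only [Set.mem_ofPred_eq, lp.coeFn_add, lapFun_add] at *
        exact hf.add hg
      smul_mem' := by
        intro c f hf
        simp only [Set.mem_ofPred_eq, lp.coeFn_smul, lapFun_smul] at *
        exact hf.const_smul c }
  toFun :=
    { toFun := fun f => ⟨lapFun G (f : GraphL2 V), f.2⟩
      map_add' := by
        intro f g
        apply lp.ext
        exact lapFun_add G _ _
      map_smul' := by
        intro c f
        apply lp.ext
        exact lapFun_smul G c _ }

/-- The data of a direct integral of Hilbert spaces `∫ A(s) dm(s)` over `[0, ∞)`: a σ-finite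
Borel measure `m`, a Hilbert space `A(s)` for each `s`, and a measurable structure on the field,
given by a sequence of sections `e n` whose mutual inner products are measurable and which is
total in every fibre. -/
structure HilbertField where
  m : Measure ℝ≥0
  sigmaFinite : SigmaFinite m
  A : ℝ≥0 → Type
  normed : ∀ s, NormedAddCommGroup (A s)
  innerProd : ∀ s, InnerProductSpace ℂ (A s)
  complete : ∀ s, CompleteSpace (A s)
  e : ℕ → ∀ s, A s
  measurable_inner : ∀ i j, Measurable fun s => ⟪e i s, e j s⟫_ℂ
  total : ∀ s, Dense (Submodule.span ℂ (Set.range fun n => e n s) : Set (A s))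

attribute [instance] HilbertField.sigmaFinite HilbertField.normed HilbertField.innerProd
  HilbertField.complete

/-- The sections that represent the elements of the direct integral: measurable sections with
square-integrable norm. (Two of them represent the same element if they agree `m`-a.e.) -/
def HilbertField.SquareIntegrable (D : HilbertField) (a : ∀ s, D.A s) : Prop :=
  (∀ i, AEMeasurable (fun s => ⟪D.e i s, a s⟫_ℂ) D.m) ∧ ∫⁻ s, ‖a s‖ₑ ^ 2 ∂D.m < ∞

/-- A spectral Fourier transform of an operator `L`: a unitary map (linear, isometric, onto) from
the Hilbert space onto a direct integral over `[0, ∞)`, which carries the domain of `L` onto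
`{a | s a(s)` is square-integrable`}` and `L` to multiplication by `s`. The value
`toFun f` is a section representing the transform of `f`, so that identities hold `m`-a.e. -/
structure SpectralFourierTransform {H : Type*} [NormedAddCommGroup H] [InnerProductSpace ℂ H]
    (L : H →ₗ.[ℂ] H) where
  D : HilbertField
  toFun : H → ∀ s, D.A s
  squareIntegrable : ∀ f, D.SquareIntegrable (toFun f)
  map_add : ∀ f g, ∀ᵐ s ∂D.m, toFun (f + g) s = toFun f s + toFun g s
  map_smul : ∀ (c : ℂ) f, ∀ᵐ s ∂D.m, toFun (c • f) s = c • toFun f s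
  norm_eq : ∀ f, ∫⁻ s, ‖toFun f s‖ₑ ^ 2 ∂D.m = ‖f‖ₑ ^ 2
  surj : ∀ a, D.SquareIntegrable a → ∃ f, ∀ᵐ s ∂D.m, toFun f s = a s
  mem_domain : ∀ f, f ∈ L.domain ↔
    D.SquareIntegrable fun s => ((s : ℝ) : ℂ) • toFun f s
  map_op : ∀ f : L.domain, ∀ᵐ s ∂D.m, toFun (L f) s = ((s : ℝ) : ℂ) • toFun f s

namespace SpectralFourierTransform

variable {H : Type*} [NormedAddCommGroup H] [InnerProductSpace ℂ H] {L : H →ₗ.[ℂ] H}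

theorem exists_exp (F : SpectralFourierTransform L) (t : ℝ) (f : H) :
    ∃ g, ∀ᵐ s ∂F.D.m,
      F.toFun g s = Complex.exp (Complex.I * (t : ℂ) * ((s : ℝ) : ℂ)) • F.toFun f s := by
  apply F.surj
  obtain ⟨h1, h2⟩ := F.squareIntegrable f
  refine ⟨fun i => ?_, ?_⟩
  · simp only [inner_smul_right]
    refine AEMeasurable.mul (Measurable.aemeasurable ?_) (h1 i)
    fun_prop
  · have h3 : ∀ s : ℝ≥0, ‖Complex.exp (Complex.I * (t : ℂ) * ((s : ℝ) : ℂ))‖ₑ = 1 := by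
      intro s
      have : ‖Complex.exp (Complex.I * (t : ℂ) * ((s : ℝ) : ℂ))‖ = 1 := by
        simp [Complex.norm_exp]
      rw [← ofReal_norm, this, ENNReal.ofReal_one]
    simpa only [enorm_smul, h3, one_mul] using h2

/-- The Schrödinger group: `e^{itL} f` is the vector whose spectral Fourier transform is
`e^{its}` times that of `f`. -/
def expI (F : SpectralFourierTransform L) (t : ℝ) (f : H) : H :=
  Classical.choose (F.exists_exp t f)

/-- The Paley–Wiener space `PW_ω(L)`: the vectors whose spectral Fourier transform has support
in `[0, ω]`, that is, vanishes a.e. outside `[0, ω]`. -/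
def PW (F : SpectralFourierTransform L) (ω : ℝ) : Set H :=
  {f | ∀ᵐ s : ℝ≥0 ∂F.D.m, (s : ℝ) ∉ Set.Icc 0 ω → F.toFun f s = 0}

end SpectralFourierTransform

end

/-! On the spectral side the group acts by multiplication by `e^{its}`. Pairing `Q = ∫ h(t) e^{itL}
f dt` with a vector and applying Fubini (`inner_integral_smul_expI`) shows that `Q` is, weakly, `f`
multiplied by `∫ h(t) e^{its} dt`. By Paley–Wiener (`integral_mul_exp_eq_zero`) this factor vanishes
for `s > ω`, so `Q` has no spectral part beyond `ω`. The vanishing comes from a contour shift into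
the upper half-plane, where `h(z) e^{isz}` decays because `h` grows at a rate only slightly above
`ω`. That growth bound is Phragmén–Lindelöf for a primitive of `h`, which is bounded on the real
line because `h` is integrable.

The existence of a transform is the spectral theorem for `L`, reached through its resolvent. A
maximum principle (`eq_zero_of_add_lapFun_eq_zero`) shows that `u + Lu = 0` has only the zero
solution in `ℓ²`, whatever the degrees are. Hence `1 + L` has dense range on finitely supported
functions. Since `L` is symmetric and nonnegative there, the inverse extends to a positive
contraction `R`, and uniqueness again identifies the range of `R` with the natural domain of `L`.
The continuous functional calculus of `R` splits the space into cyclic pieces `L²(μ n)` on which `R`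
is multiplication by the spectral variable. The substitution `z = 1 / (1 + s)` moves these to the
half-line, and densities with respect to one common measure assemble them into a direct integral. -/

/-! ### Growth of integrable entire functions of exponential type, and Paley–Wiener vanishing. -/

open Filter Topology Complex in
/-- An entire function of exponential type which is bounded on the real line is bounded by
`M * exp (σ * im z)` in the upper half-plane. -/
theorem norm_le_exp_im_of_bounded_on_real {g : ℂ → ℂ} {σ C M : ℝ} (hg : Differentiable ℂ g)
    (hσ : 0 ≤ σ) (hC : ∀ z, ‖g z‖ ≤ C * Real.exp (σ * ‖z‖)) (hM : ∀ x : ℝ, ‖g x‖ ≤ M) {z : ℂ}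
    (hz : 0 ≤ z.im) : ‖g z‖ ≤ M * Real.exp (σ * z.im) := by
  have hC0 : 0 ≤ C := by simpa using (norm_nonneg _).trans (hC 0)
  -- The rotation carries the right half-plane to the upper one. The factor `exp (-σ w)` has modulus
  -- one on the imaginary axis and compensates the growth of `g` on the positive real axis, where
  -- `f` is therefore bounded by `C`.
  set f : ℂ → ℂ := fun w => g (I * w) * Complex.exp (-σ * w) with hf
  have hfd : Differentiable ℂ f := by
    apply Differentiable.mul
    · exact hg.comp (by fun_prop)
    · fun_prop
  have hnorm : ∀ w, ‖f w‖ = ‖g (I * w)‖ * Real.exp (-σ * w.re) := by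
    intro w
    simp [hf, Complex.norm_exp]
  have key : ‖f (-I * z)‖ ≤ M := by
    apply PhragmenLindelof.right_half_plane_of_bounded_on_real hfd.diffContOnCl
    · refine ⟨1, by norm_num, 2 * σ, ?_⟩
      refine Asymptotics.IsBigO.of_bound C (Eventually.of_forall fun w => ?_)
      rw [hnorm, Real.norm_of_nonneg (Real.exp_pos _).le, Real.rpow_one]
      calc ‖g (I * w)‖ * Real.exp (-σ * w.re)
          ≤ (C * Real.exp (σ * ‖w‖)) * Real.exp (σ * ‖w‖) := by
            refine mul_le_mul (by simpa using hC (I * w)) (Real.exp_le_exp.2 ?_)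
              (Real.exp_pos _).le (by positivity)
            · have := mul_le_mul_of_nonneg_left (neg_le_of_abs_le (Complex.abs_re_le_norm w)) hσ
              linarith
        _ = C * Real.exp (2 * σ * ‖w‖) := by
            rw [mul_assoc, ← Real.exp_add]; ring_nf
    · refine isBoundedUnder_of_eventually_le (a := C) ?_
      filter_upwards [eventually_ge_atTop 0] with x hx
      rw [hnorm]
      have h1 := hC (I * x)
      simp only [norm_mul, norm_I, one_mul, norm_real, Real.norm_of_nonneg hx] at h1
      calc _ ≤ (C * Real.exp (σ * x)) * Real.exp (-σ * x) := by
            simp only [ofReal_re]; gcongr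
        _ = C := by rw [mul_assoc, ← Real.exp_add]; simp
    · intro x
      rw [hnorm]
      have : I * (x * I) = ((-x : ℝ) : ℂ) := by
        push_cast; linear_combination (x : ℂ) * I_mul_I
      rw [this]
      simpa using hM (-x)
    · simpa using hz
  rw [hnorm] at key
  have h2 : I * (-I * z) = z := by linear_combination (-z) * I_mul_I
  rw [h2] at key
  have h3 : (-I * z).re = z.im := by simp
  rw [h3] at key
  calc ‖g z‖ = ‖g z‖ * Real.exp (-σ * z.im) * Real.exp (σ * z.im) := by
        rw [mul_assoc, ← Real.exp_add]; simp
    _ ≤ _ := by gcongr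

open Filter Topology Complex in
theorem norm_le_exp_abs_im_of_bounded_on_real {g : ℂ → ℂ} {σ C M : ℝ} (hg : Differentiable ℂ g)
    (hσ : 0 ≤ σ) (hC : ∀ z, ‖g z‖ ≤ C * Real.exp (σ * ‖z‖)) (hM : ∀ x : ℝ, ‖g x‖ ≤ M) (z : ℂ) :
    ‖g z‖ ≤ M * Real.exp (σ * |z.im|) := by
  rcases le_total 0 z.im with hz | hz
  · rw [abs_of_nonneg hz]
    exact norm_le_exp_im_of_bounded_on_real hg hσ hC hM hz
  · rw [abs_of_nonpos hz]
    have := norm_le_exp_im_of_bounded_on_real (g := fun w => g (-w)) (z := -z)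
      (hg.comp differentiable_neg) hσ (fun w => by simpa using hC (-w))
      (fun x => by simpa using hM (-x)) (by simpa using hz)
    simpa using this

open Filter Topology Complex in
/-- An integrable entire function of exponential type `ω` grows at most exponentially, with any
rate `σ > ω`, away from the real line. -/
theorem IsEntireOfExpType.norm_le_exp_abs_im {ω σ : ℝ} {h : ℂ → ℂ} (hω : 0 ≤ ω)
    (hh : IsEntireOfExpType ω h) (hi : Integrable fun t : ℝ => h t) (hσ : ω < σ) :
    ∃ C : ℝ, ∀ z : ℂ, ‖h z‖ ≤ C * Real.exp (σ * |z.im|) := by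
  obtain ⟨hd, hexp⟩ := hh
  -- Boundedness of `h` on the real line is not known in advance, but its primitive is bounded there
  -- by the `L¹` norm of `h`. The half-plane estimate is applied to the primitive and carried back
  -- to `h` by Cauchy's estimate.
  obtain ⟨g, hg0, hg⟩ := hd.isExactOn_univ.with_val_at 0 0
  replace hg : ∀ z, HasDerivAt g (h z) z := fun z => hg z (Set.mem_univ z)
  have hgd : Differentiable ℂ g := fun z => (hg z).differentiableAt
  -- One `ε` is spent on the type of `h`, the other absorbs the factor `‖z‖` from the mean value
  -- inequality, so that `ω + 2ε = σ`.
  set ε := (σ - ω) / 2 with hε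
  have hε0 : 0 < ε := by rw [hε]; linarith
  have hσ0 : 0 ≤ σ := by linarith
  obtain ⟨C, hC⟩ := hexp ε hε0
  have hC0 : 0 ≤ C := by simpa using (norm_nonneg _).trans (hC 0)
  have hgb : ∀ z, ‖g z‖ ≤ (C / ε) * Real.exp (σ * ‖z‖) := by
    intro z
    have h1 : ‖g z - g 0‖ ≤ C * Real.exp ((ω + ε) * ‖z‖) * ‖z - 0‖ := by
      apply (convex_closedBall (0 : ℂ) ‖z‖).norm_image_sub_le_of_norm_hasDerivWithin_le
        (fun w _ => (hg w).hasDerivWithinAt)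
      · intro w hw
        rw [mem_closedBall_zero_iff] at hw
        refine (hC w).trans ?_
        gcongr
      · simp
      · simp
    rw [hg0, sub_zero, sub_zero] at h1
    have h2 : ‖z‖ ≤ Real.exp (ε * ‖z‖) / ε := by
      rw [le_div_iff₀ hε0]
      have := Real.add_one_le_exp (ε * ‖z‖)
      linarith
    calc ‖g z‖ ≤ C * Real.exp ((ω + ε) * ‖z‖) * (Real.exp (ε * ‖z‖) / ε) := by
          refine h1.trans ?_; gcongr
      _ = (C / ε) * (Real.exp ((ω + ε) * ‖z‖) * Real.exp (ε * ‖z‖)) := by ring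
      _ = _ := by
        rw [← Real.exp_add]
        congr 2
        rw [hε]; ring
  have hgr : ∀ x : ℝ, ‖g x‖ ≤ ∫ t : ℝ, ‖h t‖ := by
    intro x
    have hftc : ∫ t in (0 : ℝ)..x, h t = g x - g ((0 : ℝ) : ℂ) :=
      intervalIntegral.integral_eq_sub_of_hasDerivAt
        (f := fun t : ℝ => g t) (fun t _ => (hg t).comp_ofReal) hi.intervalIntegrable
    rw [ofReal_zero, hg0, sub_zero] at hftc
    rw [← hftc]
    refine intervalIntegral.norm_integral_le_integral_norm_uIoc.trans ?_
    exact setIntegral_le_integral hi.norm (Eventually.of_forall fun t => norm_nonneg _)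
  have hb := norm_le_exp_abs_im_of_bounded_on_real hgd hσ0 hgb hgr
  set M := ∫ t : ℝ, ‖h t‖
  have hM0 : 0 ≤ M := (norm_nonneg _).trans (hgr 0)
  -- The factor `exp σ` pays for the unit circle around `z`, on which `|im w| ≤ |im z| + 1`.
  refine ⟨M * Real.exp σ, fun z => ?_⟩
  rw [← (hg z).deriv]
  refine (Complex.norm_deriv_le_of_forall_mem_sphere_norm_le (C := M * Real.exp σ *
    Real.exp (σ * |z.im|)) one_pos hgd.diffContOnCl fun w hw => (hb w).trans ?_).trans (by simp)
  rw [mul_assoc, ← Real.exp_add]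
  gcongr
  have h1 : |w.im - z.im| ≤ 1 := by
    have := Complex.abs_im_le_norm (w - z)
    rw [mem_sphere_iff_norm] at hw
    simpa [hw] using this
  have h2 : |w.im| ≤ 1 + |z.im| := by
    have := abs_add_le (w.im - z.im) z.im
    rw [sub_add_cancel] at this
    linarith
  nlinarith

-- The kernel has its only pole at `-i / η`, in the lower half-plane, so Cauchy's theorem applies to
-- rectangles standing on the real axis. The exponential kills the top side and the quadratic decay
-- of the kernel kills the vertical sides.
open Filter Topology Complex in
theorem IsEntireOfExpType.integral_mul_kernel_eq_zero {ω lam η : ℝ} {h : ℂ → ℂ} (hω : 0 ≤ ω)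
    (hh : IsEntireOfExpType ω h) (hi : Integrable fun t : ℝ => h t) (hlam : ω < lam)
    (hη : 0 < η) :
    ∫ t : ℝ, h t * Complex.exp (I * lam * t) * ((1 - I * η * t) ^ 2)⁻¹ = 0 := by
  -- A rate strictly between `ω` and `lam`: it bounds the growth of `h` and leaves the decay rate `c
  -- > 0`.
  set σ := (ω + lam) / 2 with hσ
  set c := lam - σ with hc
  have hc0 : 0 < c := by rw [hc, hσ]; linarith
  obtain ⟨C, hC⟩ := hh.norm_le_exp_abs_im hω hi (σ := σ) (by rw [hσ]; linarith)
  have hC0 : 0 ≤ C := by simpa using (norm_nonneg _).trans (hC 0)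
  set G : ℂ → ℂ := fun z => h z * Complex.exp (I * lam * z) * ((1 - I * η * z) ^ 2)⁻¹ with hG
  have hre : ∀ z : ℂ, (1 - I * η * z).re = 1 + η * z.im := by intro z; simp
  have him : ∀ z : ℂ, (1 - I * η * z).im = - (η * z.re) := by intro z; simp
  have h1le : ∀ z : ℂ, 0 ≤ z.im → 1 ≤ ‖1 - I * η * z‖ := by
    intro z hz
    refine le_trans ?_ (Complex.re_le_norm _)
    rw [hre]; nlinarith
  have hTle : ∀ z : ℂ, η * |z.re| ≤ ‖1 - I * η * z‖ := by
    intro z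
    refine le_trans ?_ (Complex.abs_im_le_norm _)
    rw [him, abs_neg, abs_mul, abs_of_pos hη]
  have hne : ∀ z : ℂ, 0 ≤ z.im → 1 - I * η * z ≠ 0 := by
    intro z hz h0
    have := h1le z hz
    rw [h0, norm_zero] at this
    linarith
  have hGd : DifferentiableOn ℂ G {z | 0 ≤ z.im} := by
    intro z hz
    have h1 : DifferentiableAt ℂ h z := hh.1 z
    have h2 : (1 - I * η * z) ^ 2 ≠ 0 := pow_ne_zero 2 (hne z hz)
    apply DifferentiableAt.differentiableWithinAt
    refine (h1.mul (by fun_prop)).mul (DifferentiableAt.inv (by fun_prop) h2)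
  have hGb : ∀ z : ℂ, 0 ≤ z.im →
      ‖G z‖ ≤ C * Real.exp (-c * z.im) * (‖1 - I * η * z‖ ^ 2)⁻¹ := by
    intro z hz
    have h1 := hC z
    rw [abs_of_nonneg hz] at h1
    have h2 : ‖Complex.exp (I * lam * z)‖ = Real.exp (-lam * z.im) := by
      rw [Complex.norm_exp]; simp
    simp only [hG, norm_mul, norm_inv, norm_pow, h2]
    refine mul_le_mul_of_nonneg_right ?_ (by positivity)
    calc ‖h z‖ * Real.exp (-lam * z.im)
        ≤ C * Real.exp (σ * z.im) * Real.exp (-lam * z.im) := by gcongr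
      _ = _ := by
        rw [mul_assoc, ← Real.exp_add, hc]; ring_nf
  have hGi : Integrable fun t : ℝ => G t := by
    refine hi.norm.mono' ?_ (Eventually.of_forall fun t => ?_)
    · apply Continuous.aestronglyMeasurable
      have : ContinuousOn (fun t : ℝ => G t) Set.univ :=
        hGd.continuousOn.comp (by fun_prop) (fun t _ => by simp)
      exact continuousOn_univ.1 this
    · have h2 : ‖Complex.exp (I * lam * t)‖ = 1 := by
        rw [Complex.norm_exp]; simp
      simp only [hG, norm_mul, norm_inv, norm_pow, h2, mul_one]
      refine mul_le_of_le_one_right (norm_nonneg _) (inv_le_one_of_one_le₀ ?_)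
      exact one_le_pow₀ (h1le t (by simp))
  -- The rectangle is `[-T, T] × [0, T]`. The top side has length `2T` and integrand at most `C exp
  -- (-cT)`; each vertical side has length `T` and integrand at most `C / (ηT)²`.
  have hrect : ∀ T : ℝ, 0 < T → ‖∫ x in (-T)..T, G x‖ ≤
      2 * C * (T * Real.exp (-c * T)) + 2 * C / η ^ 2 * T⁻¹ := by
    intro T hT
    have key := Complex.integral_boundary_rect_eq_zero_of_differentiableOn G (-T : ℝ)
      (T + T * I) (hGd.mono ?_)
    · simp only [ofReal_re, ofReal_im, add_re, add_im, mul_re, mul_im, I_re, I_im, mul_zero,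
        mul_one, sub_zero, zero_mul, add_zero, zero_add, ofReal_zero] at key
      have htop : ‖∫ x in (-T)..T, G (x + T * I)‖ ≤ C * Real.exp (-c * T) * |T - -T| := by
        apply intervalIntegral.norm_integral_le_of_norm_le_const
        intro x _
        have hz : ((x : ℂ) + T * I).im = T := by simp
        refine (hGb _ (by rw [hz]; exact hT.le)).trans ?_
        have := h1le ((x : ℂ) + T * I) (by rw [hz]; exact hT.le)
        rw [hz]
        exact mul_le_of_le_one_right (by positivity) (inv_le_one_of_one_le₀ (one_le_pow₀ this))
      have hside : ∀ a : ℝ, |a| = T → ‖∫ y in (0 : ℝ)..T, G (a + y * I)‖ ≤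
          C * ((η * T) ^ 2)⁻¹ * |T - 0| := by
        intro a ha
        apply intervalIntegral.norm_integral_le_of_norm_le_const
        intro y hy
        rw [Set.uIoc_of_le hT.le] at hy
        have hz : ((a : ℂ) + y * I).im = y := by simp
        have hz' : ((a : ℂ) + y * I).re = a := by simp
        refine (hGb _ (by rw [hz]; exact hy.1.le)).trans ?_
        have := hTle ((a : ℂ) + y * I)
        rw [hz', ha] at this
        have h3 : Real.exp (-c * ((a : ℂ) + y * I).im) ≤ 1 := by
          rw [hz, Real.exp_le_one_iff]
          nlinarith [hy.1]
        gcongr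
        exact mul_le_of_le_one_right hC0 h3
      have hr := hside T (abs_of_pos hT)
      have hl := hside (-T) (by rw [abs_neg, abs_of_pos hT])
      push_cast at hl key
      have e : ∫ x in (-T)..T, G x = (∫ x in (-T)..T, G (x + T * I)) -
          I • (∫ y in (0 : ℝ)..T, G (T + y * I)) + I • (∫ y in (0 : ℝ)..T, G (-T + y * I)) := by
        linear_combination key
      rw [e]
      refine (norm_add_le _ _).trans ((add_le_add_left (norm_sub_le _ _) _).trans ?_)
      rw [norm_smul, norm_smul, norm_I, one_mul, one_mul]
      have e1 : |T - -T| = 2 * T := by rw [abs_of_pos] <;> linarith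
      have e2 : |T - 0| = T := by rw [sub_zero, abs_of_pos hT]
      rw [e1] at htop
      rw [e2] at hr hl
      have e3 : C * ((η * T) ^ 2)⁻¹ * T = C / η ^ 2 * T⁻¹ := by
        field_simp
      rw [e3] at hr hl
      linear_combination htop + hr + hl
    · intro z hz
      have := hz.2
      simp only [ofReal_im, add_im, mul_im, I_im, I_re, ofReal_re, mul_one, mul_zero, add_zero,
        zero_add, Set.mem_preimage] at this
      rw [Set.uIcc_of_le hT.le] at this
      exact this.1
  have hlim : Tendsto (fun T : ℝ => ∫ x in (-T)..T, G x) atTop (𝓝 (∫ x : ℝ, G x)) :=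
    intervalIntegral_tendsto_integral hGi tendsto_neg_atTop_atBot tendsto_id
  have hlim0 : Tendsto (fun T : ℝ => ∫ x in (-T)..T, G x) atTop (𝓝 0) := by
    refine squeeze_zero_norm' (a := fun T : ℝ => 2 * C * (T * Real.exp (-c * T)) +
      2 * C / η ^ 2 * T⁻¹) ?_ ?_
    · filter_upwards [eventually_gt_atTop 0] with T hT using hrect T hT
    · have h1 : Tendsto (fun T : ℝ => T * Real.exp (-c * T)) atTop (𝓝 0) := by
        simpa using tendsto_rpow_mul_exp_neg_mul_atTop_nhds_zero 1 c hc0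
      have := (h1.const_mul (2 * C)).add (tendsto_inv_atTop_zero.const_mul (2 * C / η ^ 2))
      simpa using this
  exact tendsto_nhds_unique hlim hlim0

open Filter Topology Complex in
/-- **Paley–Wiener**: the Fourier transform of an integrable entire function of exponential type
`ω` vanishes outside `[-ω, ω]` (here: to the right of `ω`). -/
theorem IsEntireOfExpType.integral_mul_exp_eq_zero {ω lam : ℝ} {h : ℂ → ℂ} (hω : 0 ≤ ω)
    (hh : IsEntireOfExpType ω h) (hi : Integrable fun t : ℝ => h t) (hlam : ω < lam) :
    ∫ t : ℝ, h t * Complex.exp (I * t * lam) = 0 := by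
  -- The kernel is removed by letting `η = 1 / (n + 1)` tend to zero; its modulus is at most one on
  -- the real line, so `‖h‖` dominates.
  have hlim : Tendsto (fun n : ℕ => ∫ t : ℝ, h t * Complex.exp (I * lam * t) *
      ((1 - I * ((1 / ((n : ℝ) + 1) : ℝ) : ℂ) * t) ^ 2)⁻¹) atTop
      (𝓝 (∫ t : ℝ, h t * Complex.exp (I * lam * t))) := by
    have hn1 : ∀ (n : ℕ) (t : ℝ), 1 ≤ ‖1 - I * ((1 / ((n : ℝ) + 1) : ℝ) : ℂ) * t‖ := by
      intro n t
      refine le_trans ?_ (Complex.re_le_norm _)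
      simp
    refine tendsto_integral_of_dominated_convergence (fun t => ‖h t‖) ?_ hi.norm ?_ ?_
    · intro n
      have h1 : Continuous fun t : ℝ => h t := hh.1.continuous.comp continuous_ofReal
      apply Continuous.aestronglyMeasurable
      refine (h1.mul (by fun_prop)).mul (Continuous.inv₀ (by fun_prop) fun t => ?_)
      intro h0
      have := hn1 n t
      rw [pow_eq_zero_iff two_ne_zero] at h0
      rw [h0, norm_zero] at this
      linarith
    · intro n
      refine Eventually.of_forall fun t => ?_
      have h2 : ‖Complex.exp (I * lam * t)‖ = 1 := by
        rw [Complex.norm_exp]; simp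
      have := hn1 n t
      rw [norm_mul, norm_mul, norm_inv, norm_pow, h2, mul_one]
      exact mul_le_of_le_one_right (norm_nonneg _) (inv_le_one_of_one_le₀ (one_le_pow₀ this))
    · refine Eventually.of_forall fun t => ?_
      have h1 : Tendsto (fun n : ℕ => ((1 / ((n : ℝ) + 1) : ℝ) : ℂ)) atTop (𝓝 ((0 : ℝ) : ℂ)) :=
        (continuous_ofReal.tendsto 0).comp tendsto_one_div_add_atTop_nhds_zero_nat
      have h2 : Tendsto (fun n : ℕ => ((1 - I * ((1 / ((n : ℝ) + 1) : ℝ) : ℂ) * t) ^ 2)⁻¹) atTop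
          (𝓝 ((1 - I * ((0 : ℝ) : ℂ) * t) ^ 2)⁻¹) :=
        (((tendsto_const_nhds.sub ((h1.const_mul I).mul_const _))).pow 2).inv₀ (by simp)
      simpa using h2.const_mul (h t * Complex.exp (I * lam * t))
  have h0 : ∀ n : ℕ, ∫ t : ℝ, h t * Complex.exp (I * lam * t) *
      ((1 - I * ((1 / ((n : ℝ) + 1) : ℝ) : ℂ) * t) ^ 2)⁻¹ = 0 := fun n =>
    hh.integral_mul_kernel_eq_zero hω hi hlam (by positivity)
  simp only [h0] at hlim
  simp only [mul_right_comm I _ (lam : ℂ)]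
  exact (tendsto_nhds_unique tendsto_const_nhds hlim).symm

/-! ### Measurability and square-integrability of sections of a Hilbert field. -/

noncomputable section

theorem inner_eq_sum_complex_norm_sq_div_four {E : Type*} [NormedAddCommGroup E]
    [InnerProductSpace ℂ E] (x y : E) :
    ⟪x, y⟫_ℂ = ((‖x + y‖ : ℂ) ^ 2 - (‖x - y‖ : ℂ) ^ 2 +
      ((‖x - Complex.I • y‖ : ℂ) ^ 2 - (‖x + Complex.I • y‖ : ℂ) ^ 2) * Complex.I) / 4 :=
  inner_eq_sum_norm_sq_div_four x y

namespace HilbertField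

/-- A countable family of measurable sections whose values are dense in every fibre. -/
def denseSection (D : HilbertField) (p : ℕ × ℕ) (s : ℝ≥0) : D.A s :=
  ∑ i : Fin p.1, TopologicalSpace.denseSeq (Fin p.1 → ℂ) p.2 i • D.e i s

theorem dense_range_denseSection (D : HilbertField) (s : ℝ≥0) :
    Dense (Set.range fun p => D.denseSection p s) := by
  rw [← dense_closure]
  refine (D.total s).mono fun x hx => ?_
  rw [SetLike.mem_coe, Finsupp.mem_span_range_iff_exists_finsupp] at hx
  obtain ⟨c, rfl⟩ := hx
  obtain ⟨n, hn⟩ : ∃ n, c.support ⊆ Finset.range n :=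
    ⟨c.support.sup id + 1, fun i hi => Finset.mem_range.2 <|
      Nat.lt_succ_of_le (Finset.le_sup (f := id) hi)⟩
  have hsum : (c.sum fun i a => a • D.e i s) =
      (fun d : Fin n → ℂ => ∑ i : Fin n, d i • D.e i s) (fun i => c i) := by
    rw [Finsupp.sum_of_support_subset c hn _ (by simp)]
    exact (Fin.sum_univ_eq_sum_range (fun i => c i • D.e i s) n).symm
  rw [hsum]
  have hcont : Continuous (fun d : Fin n → ℂ => ∑ i : Fin n, d i • D.e i s) := by fun_prop
  refine map_mem_closure (f := fun d : Fin n → ℂ => ∑ i : Fin n, d i • D.e i s) hcont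
    (TopologicalSpace.denseRange_denseSeq (Fin n → ℂ) (fun i : Fin n => c i)) ?_
  rintro _ ⟨k, rfl⟩
  exact ⟨(n, k), rfl⟩

/-- A field is given only through inner products with the `e n`; writing the norm as a countable
supremum of such data makes it measurable. Where a dense section vanishes the quotient is `0 / 0 =
0`, which does no harm. -/
theorem enorm_eq_iSup_denseSection (D : HilbertField) (s : ℝ≥0) (x : D.A s) :
    ‖x‖ₑ = ⨆ p, ‖⟪D.denseSection p s, x⟫_ℂ‖ₑ / ‖D.denseSection p s‖ₑ := by
  apply le_antisymm
  · rcases eq_or_ne x 0 with rfl | hx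
    · simp
    obtain ⟨v, hv, hlim⟩ := mem_closure_iff_seq_limit.1 (D.dense_range_denseSection s x)
    have hq : Filter.Tendsto (fun n => ‖⟪v n, x⟫_ℂ‖ₑ / ‖v n‖ₑ) Filter.atTop
        (nhds (‖⟪x, x⟫_ℂ‖ₑ / ‖x‖ₑ)) :=
      ENNReal.Tendsto.div (hlim.inner tendsto_const_nhds).enorm (by simp [hx]) hlim.enorm
        (by simp)
    have hxx : ‖⟪x, x⟫_ℂ‖ₑ / ‖x‖ₑ = ‖x‖ₑ := by
      rw [← ofReal_norm, ← inner_self_re_eq_norm, inner_self_eq_norm_mul_norm, ENNReal.ofReal_mul (norm_nonneg _), ofReal_norm,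
        ENNReal.mul_div_cancel_right (by simpa using hx) (by simp)]
    rw [hxx] at hq
    refine le_of_tendsto' hq fun n => ?_
    obtain ⟨p, hp⟩ := hv n
    rw [← hp]
    exact le_iSup (fun p => ‖⟪D.denseSection p s, x⟫_ℂ‖ₑ / ‖D.denseSection p s‖ₑ) p
  · refine iSup_le fun p => ENNReal.div_le_of_le_mul ?_
    rw [mul_comm]
    simpa [← ofReal_norm, ← ENNReal.ofReal_mul] using
      ENNReal.ofReal_le_ofReal (norm_inner_le_norm (D.denseSection p s) x)

/-- Measurability (almost everywhere) of a section. -/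
def AEMeasurableSection (D : HilbertField) (a : ∀ s, D.A s) : Prop :=
  ∀ i, AEMeasurable (fun s => ⟪D.e i s, a s⟫_ℂ) D.m

variable {D : HilbertField} {a b : ∀ s, D.A s}

theorem AEMeasurableSection.add (ha : D.AEMeasurableSection a) (hb : D.AEMeasurableSection b) :
    D.AEMeasurableSection fun s => a s + b s := fun i => by
  simp only [inner_add_right]
  exact (ha i).add (hb i)

theorem AEMeasurableSection.smul (ha : D.AEMeasurableSection a) {φ : ℝ≥0 → ℂ}
    (hφ : AEMeasurable φ D.m) : D.AEMeasurableSection fun s => φ s • a s := fun i => by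
  simp only [inner_smul_right]
  exact hφ.mul (ha i)

theorem AEMeasurableSection.aemeasurable_enorm (ha : D.AEMeasurableSection a) :
    AEMeasurable (fun s => ‖a s‖ₑ) D.m := by
  have h1 : ∀ p, AEMeasurable (fun s => ⟪D.denseSection p s, a s⟫_ℂ) D.m := by
    intro p
    simp only [denseSection, sum_inner, inner_smul_left]
    exact Finset.aemeasurable_fun_sum _ fun i _ => (ha i).const_mul _
  have h2 : ∀ p, Measurable fun s => ‖D.denseSection p s‖ₑ := by
    intro p
    have h3 : Measurable fun s => ⟪D.denseSection p s, D.denseSection p s⟫_ℂ := by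
      simp only [denseSection, sum_inner, inner_smul_left, inner_sum, inner_smul_right]
      exact Finset.measurable_fun_sum _ fun i _ => (Finset.measurable_fun_sum _
        fun j _ => (D.measurable_inner _ _).const_mul _).const_mul _
    simp only [← ofReal_norm]
    refine ENNReal.measurable_ofReal.comp ?_
    have h4 : ∀ s, ‖D.denseSection p s‖ = √(Complex.re ⟪D.denseSection p s, D.denseSection p s⟫_ℂ) :=
      fun s => norm_eq_sqrt_re_inner (𝕜 := ℂ) _
    simp only [h4]
    exact (Complex.measurable_re.comp h3).sqrt
  have h5 : (fun s => ‖a s‖ₑ) = fun s =>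
      ⨆ p, ‖⟪D.denseSection p s, a s⟫_ℂ‖ₑ / ‖D.denseSection p s‖ₑ :=
    funext fun s => D.enorm_eq_iSup_denseSection s (a s)
  rw [h5]
  exact AEMeasurable.iSup fun p => (h1 p).enorm.div (h2 p).aemeasurable

theorem AEMeasurableSection.aemeasurable_norm (ha : D.AEMeasurableSection a) :
    AEMeasurable (fun s => ‖a s‖) D.m := by
  simpa only [toReal_enorm] using ha.aemeasurable_enorm.ennreal_toReal

/-- Polarization reduces this to measurability of norms. -/
theorem AEMeasurableSection.aemeasurable_inner (ha : D.AEMeasurableSection a)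
    (hb : D.AEMeasurableSection b) : AEMeasurable (fun s => ⟪a s, b s⟫_ℂ) D.m := by
  have h : ∀ c : ℂ, AEMeasurable (fun s => ((‖a s + c • b s‖ : ℝ) : ℂ)) D.m := fun c =>
    Complex.measurable_ofReal.comp_aemeasurable
      (ha.add (hb.smul (φ := fun _ => c) aemeasurable_const)).aemeasurable_norm
  have h1 := h 1
  have h2 := h (-1)
  have h3 := h (-Complex.I)
  have h4 := h Complex.I
  simp only [one_smul, neg_smul, ← sub_eq_add_neg] at h1 h2 h3
  simp only [inner_eq_sum_complex_norm_sq_div_four]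
  exact (((h1.pow_const 2).sub (h2.pow_const 2)).add
    (((h3.pow_const 2).sub (h4.pow_const 2)).mul_const _)).div_const _

theorem SquareIntegrable.aemeasurableSection (ha : D.SquareIntegrable a) :
    D.AEMeasurableSection a := ha.1

theorem SquareIntegrable.congr (ha : D.SquareIntegrable a) (h : ∀ᵐ s ∂D.m, a s = b s) :
    D.SquareIntegrable b := by
  refine ⟨fun i => (ha.1 i).congr ?_, ?_⟩
  · filter_upwards [h] with s hs
    rw [hs]
  · refine lt_of_eq_of_lt (lintegral_congr_ae ?_) ha.2
    filter_upwards [h] with s hs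
    rw [hs]

theorem SquareIntegrable.integrable_norm_sq (ha : D.SquareIntegrable a) :
    Integrable (fun s => ‖a s‖ ^ 2) D.m := by
  refine ⟨(ha.aemeasurableSection.aemeasurable_norm.pow_const 2).aestronglyMeasurable, ?_⟩
  rw [HasFiniteIntegral]
  simpa only [enorm_pow, enorm_norm] using ha.2

theorem squareIntegrable_of_integrable (ha : D.AEMeasurableSection a)
    (h : Integrable (fun s => ‖a s‖ ^ 2) D.m) : D.SquareIntegrable a := by
  refine ⟨ha, ?_⟩
  have := h.2
  rw [HasFiniteIntegral] at this
  simpa only [enorm_pow, enorm_norm] using this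

theorem SquareIntegrable.add (ha : D.SquareIntegrable a) (hb : D.SquareIntegrable b) :
    D.SquareIntegrable fun s => a s + b s := by
  have hm := ha.aemeasurableSection.add hb.aemeasurableSection
  refine squareIntegrable_of_integrable hm
    (((ha.integrable_norm_sq.const_mul 2).add (hb.integrable_norm_sq.const_mul 2)).mono'
      (hm.aemeasurable_norm.pow_const 2).aestronglyMeasurable (Filter.Eventually.of_forall ?_))
  intro s
  rw [Real.norm_of_nonneg (by positivity)]
  have h1 := norm_add_le (a s) (b s)
  have h2 := norm_nonneg (a s + b s)
  simp only [Pi.add_apply]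
  nlinarith [sq_nonneg (‖a s‖ - ‖b s‖)]

theorem SquareIntegrable.smul_of_bounded (ha : D.SquareIntegrable a) {φ : ℝ≥0 → ℂ} {C : ℝ}
    (hφ : AEMeasurable φ D.m) (hC : ∀ s, ‖φ s‖ ≤ C) :
    D.SquareIntegrable fun s => φ s • a s := by
  have hm := ha.aemeasurableSection.smul hφ
  refine squareIntegrable_of_integrable hm
    ((ha.integrable_norm_sq.const_mul (C ^ 2)).mono'
      (hm.aemeasurable_norm.pow_const 2).aestronglyMeasurable (Filter.Eventually.of_forall ?_))
  intro s
  rw [Real.norm_of_nonneg (by positivity), norm_smul, mul_pow]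
  gcongr
  exact hC s

theorem SquareIntegrable.integrable_inner (ha : D.SquareIntegrable a)
    (hb : D.SquareIntegrable b) : Integrable (fun s => ⟪a s, b s⟫_ℂ) D.m := by
  refine (ha.integrable_norm_sq.add hb.integrable_norm_sq).mono'
    (ha.aemeasurableSection.aemeasurable_inner hb.aemeasurableSection).aestronglyMeasurable
    (Filter.Eventually.of_forall ?_)
  intro s
  have := norm_inner_le_norm (𝕜 := ℂ) (a s) (b s)
  simp only [Pi.add_apply]
  nlinarith [sq_nonneg (‖a s‖ - ‖b s‖), norm_nonneg (a s), norm_nonneg (b s)]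

end HilbertField

/-! ### Plancherel, the Schrödinger group and the Paley–Wiener space. -/

namespace SpectralFourierTransform

variable {H : Type*} [NormedAddCommGroup H] [InnerProductSpace ℂ H] {L : H →ₗ.[ℂ] H}
variable (F : SpectralFourierTransform L)

theorem toFun_add_smul (f g : H) (c : ℂ) :
    ∀ᵐ s ∂F.D.m, F.toFun (f + c • g) s = F.toFun f s + c • F.toFun g s := by
  filter_upwards [F.map_add f (c • g), F.map_smul c g] with s h1 h2
  rw [h1, h2]

theorem toFun_sub (f g : H) :
    ∀ᵐ s ∂F.D.m, F.toFun (f - g) s = F.toFun f s - F.toFun g s := by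
  simpa only [neg_smul, one_smul, ← sub_eq_add_neg] using F.toFun_add_smul f g (-1)

theorem integral_norm_sq (f : H) : ∫ s, ‖F.toFun f s‖ ^ 2 ∂F.D.m = ‖f‖ ^ 2 := by
  rw [integral_eq_lintegral_of_nonneg_ae (Filter.Eventually.of_forall fun s => by positivity)
    (F.squareIntegrable f).integrable_norm_sq.1]
  have : ∀ s, ENNReal.ofReal (‖F.toFun f s‖ ^ 2) = ‖F.toFun f s‖ₑ ^ 2 := fun s => by
    rw [ENNReal.ofReal_pow (norm_nonneg _), ofReal_norm]
  simp only [this, F.norm_eq, ENNReal.toReal_pow, toReal_enorm]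

theorem norm_sq_eq_integral {f : H} {a : ∀ s, F.D.A s}
    (h : ∀ᵐ s ∂F.D.m, F.toFun f s = a s) : ‖f‖ ^ 2 = ∫ s, ‖a s‖ ^ 2 ∂F.D.m := by
  rw [← F.integral_norm_sq f]
  refine integral_congr_ae ?_
  filter_upwards [h] with s hs
  rw [hs]

/-- The transform preserves norms and is linear almost everywhere, so polarization on both sides
gives the inner product. -/
theorem inner_eq_integral (f g : H) :
    ⟪f, g⟫_ℂ = ∫ s, ⟪F.toFun f s, F.toFun g s⟫_ℂ ∂F.D.m := by
  have h : ∀ c : ℂ, ((‖f + c • g‖ : ℂ)) ^ 2 =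
      ∫ s, ((‖F.toFun f s + c • F.toFun g s‖ : ℂ)) ^ 2 ∂F.D.m := by
    intro c
    have := F.norm_sq_eq_integral (F.toFun_add_smul f g c)
    simp only [← Complex.ofReal_pow]
    rw [this, integral_complex_ofReal]
  have hi : ∀ c : ℂ, Integrable (fun s => ((‖F.toFun f s + c • F.toFun g s‖ : ℂ)) ^ 2) F.D.m := by
    intro c
    simp only [← Complex.ofReal_pow]
    exact ((F.squareIntegrable f).add ((F.squareIntegrable g).smul_of_bounded
      (φ := fun _ => c) aemeasurable_const (fun _ => le_rfl))).integrable_norm_sq.ofReal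
  have h1 := h 1
  have h2 := h (-1)
  have h3 := h (-Complex.I)
  have h4 := h Complex.I
  have i1 := hi 1
  have i2 := hi (-1)
  have i3 := hi (-Complex.I)
  have i4 := hi Complex.I
  simp only [one_smul, neg_smul, ← sub_eq_add_neg] at h1 h2 h3 i1 i2 i3
  simp only [inner_eq_sum_complex_norm_sq_div_four]
  rw [h1, h2, h3, h4, integral_div]
  congr 1
  rw [← integral_sub i1 i2, ← integral_sub i3 i4, ← integral_mul_const]
  exact (integral_add (i1.sub i2) ((i3.sub i4).mul_const _)).symm

theorem toFun_expI (t : ℝ) (f : H) : ∀ᵐ s ∂F.D.m, F.toFun (F.expI t f) s =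
    Complex.exp (Complex.I * (t : ℂ) * ((s : ℝ) : ℂ)) • F.toFun f s :=
  Classical.choose_spec (F.exists_exp t f)

theorem norm_exp_I_mul_mul (t s : ℝ) : ‖Complex.exp (Complex.I * (t : ℂ) * (s : ℂ))‖ = 1 := by
  simp [Complex.norm_exp]

theorem norm_expI (t : ℝ) (f : H) : ‖F.expI t f‖ = ‖f‖ := by
  have := F.norm_sq_eq_integral (F.toFun_expI t f)
  simp only [norm_smul, norm_exp_I_mul_mul, one_mul, F.integral_norm_sq] at this
  exact (sq_eq_sq₀ (norm_nonneg _) (norm_nonneg _)).1 this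

/-- Strong continuity is dominated convergence on the spectral side; it supplies the measurability
needed for the Bochner integral. -/
theorem continuous_expI (f : H) : Continuous fun t => F.expI t f := by
  rw [continuous_iff_continuousAt]
  intro t₀
  rw [ContinuousAt, tendsto_iff_norm_sub_tendsto_zero]
  have h1 : ∀ t, ‖F.expI t f - F.expI t₀ f‖ ^ 2 =
      ∫ s, ‖(Complex.exp (Complex.I * (t : ℂ) * ((s : ℝ) : ℂ)) -
        Complex.exp (Complex.I * (t₀ : ℂ) * ((s : ℝ) : ℂ))) • F.toFun f s‖ ^ 2 ∂F.D.m := by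
    intro t
    apply F.norm_sq_eq_integral
    filter_upwards [F.toFun_sub (F.expI t f) (F.expI t₀ f), F.toFun_expI t f,
      F.toFun_expI t₀ f] with s h1 h2 h3
    rw [h1, h2, h3, sub_smul]
  have h2 : Continuous fun t : ℝ =>
      ∫ s, ‖(Complex.exp (Complex.I * (t : ℂ) * ((s : ℝ) : ℂ)) -
        Complex.exp (Complex.I * (t₀ : ℂ) * ((s : ℝ) : ℂ))) • F.toFun f s‖ ^ 2 ∂F.D.m := by
    refine continuous_of_dominated (bound := fun s => 2 ^ 2 * ‖F.toFun f s‖ ^ 2) ?_ ?_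
      ((F.squareIntegrable f).integrable_norm_sq.const_mul _) ?_
    · intro t
      refine (AEMeasurable.pow_const (HilbertField.AEMeasurableSection.aemeasurable_norm
        ((F.squareIntegrable f).aemeasurableSection.smul (Measurable.aemeasurable ?_)))
        2).aestronglyMeasurable
      fun_prop
    · intro t
      refine Filter.Eventually.of_forall fun s => ?_
      rw [Real.norm_of_nonneg (by positivity), norm_smul, mul_pow]
      gcongr
      refine (norm_sub_le _ _).trans ?_
      rw [norm_exp_I_mul_mul, norm_exp_I_mul_mul]
      norm_num
    · refine Filter.Eventually.of_forall fun s => ?_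
      simp only [norm_smul]
      fun_prop
  have h3 := (h2.tendsto t₀)
  simp only [← h1] at h3
  simpa using h3.sqrt

/-- For integrable `h`, the function `t ↦ h t • e^{itL} f` is Bochner integrable. -/
theorem integrable_smul_expI {h : ℝ → ℂ} (hh : Integrable h) (f : H) :
    Integrable fun t : ℝ => h t • F.expI t f := by
  refine (hh.norm.mul_const ‖f‖).mono'
    (hh.1.smul (F.continuous_expI f).aestronglyMeasurable) (Filter.Eventually.of_forall fun t => ?_)
  rw [norm_smul, norm_expI]

/-- Fubini in weak form: the spectral multiplier of the integral is the Fourier integral of `h`.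
Pairing with `g` avoids choosing jointly measurable representatives of the transforms of `e^{itL}
f`. -/
theorem inner_integral_smul_expI [CompleteSpace H] {h : ℝ → ℂ} (hh : Integrable h) (f g : H) :
    ⟪g, ∫ t : ℝ, h t • F.expI t f⟫_ℂ =
      ∫ s, (∫ t : ℝ, h t * Complex.exp (Complex.I * (t : ℂ) * ((s : ℝ) : ℂ))) *
        ⟪F.toFun g s, F.toFun f s⟫_ℂ ∂F.D.m := by
  set k : ℝ≥0 → ℂ := fun s => ⟪F.toFun g s, F.toFun f s⟫_ℂ with hk
  have hki : Integrable k F.D.m := (F.squareIntegrable g).integrable_inner (F.squareIntegrable f)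
  rw [← integral_inner (F.integrable_smul_expI hh f)]
  have h1 : ∀ t : ℝ, ⟪g, h t • F.expI t f⟫_ℂ =
      ∫ s, Complex.exp (Complex.I * (t : ℂ) * ((s : ℝ) : ℂ)) * (h t * k s) ∂F.D.m := by
    intro t
    rw [inner_smul_right, F.inner_eq_integral, ← integral_const_mul]
    refine integral_congr_ae ?_
    filter_upwards [F.toFun_expI t f] with s hs
    rw [hs, inner_smul_right]
    ring
  simp only [h1]
  rw [integral_integral_swap]
  · refine integral_congr_ae (Filter.Eventually.of_forall fun s => ?_)
    simp only
    rw [← integral_mul_const]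
    refine integral_congr_ae (Filter.Eventually.of_forall fun t => ?_)
    simp only
    ring
  · refine (hh.mul_prod hki).bdd_mul (c := 1) ?_ (Filter.Eventually.of_forall fun p => ?_)
    · refine Measurable.aestronglyMeasurable ?_
      fun_prop
    · exact (norm_exp_I_mul_mul _ _).le

theorem integral_smul_expI_mem_PW [CompleteSpace H] {ω : ℝ} (hω : 0 ≤ ω) {h : ℂ → ℂ}
    (hh : IsEntireOfExpType ω h) (hi : Integrable fun t : ℝ => h t) (f : H) :
    ∫ t : ℝ, h t • F.expI t f ∈ F.PW ω := by
  set Q := ∫ t : ℝ, h t • F.expI t f with hQ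
  set φ : ℝ≥0 → ℂ := fun s => if ω < s then 1 else 0 with hφ
  have hφm : Measurable φ :=
    Measurable.ite (measurableSet_lt measurable_const measurable_coe_nnreal_real)
      measurable_const measurable_const
  -- The test vector `g` is the spectral part of `Q` above `ω`. Then `⟪g, Q⟫` equals `‖g‖²`, yet it
  -- is zero because the multiplier vanishes above `ω` and the transform of `g` vanishes below.
  obtain ⟨g, hg⟩ := F.surj _ ((F.squareIntegrable Q).smul_of_bounded (C := 1)
    hφm.aemeasurable (fun s => by simp only [hφ]; split_ifs <;> simp))
  have h0 : ⟪g, Q⟫_ℂ = 0 := by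
    rw [hQ, F.inner_integral_smul_expI hi]
    refine integral_eq_zero_of_ae ?_
    filter_upwards [hg] with s hs
    by_cases hsω : ω < s
    · simp [hh.integral_mul_exp_eq_zero hω hi hsω]
    · simp [hs, hφ, hsω]
  have h1 : ⟪g, Q⟫_ℂ = ⟪g, g⟫_ℂ := by
    rw [F.inner_eq_integral, F.inner_eq_integral]
    refine integral_congr_ae ?_
    filter_upwards [hg] with s hs
    by_cases hsω : ω < s
    · simp [hs, hφ, hsω]
    · simp [hs, hφ, hsω]
  have h2 : g = 0 := inner_self_eq_zero.1 (h1.symm.trans h0)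
  have h3 := F.integral_norm_sq g
  rw [h2, norm_zero, zero_pow two_ne_zero, ← h2, integral_eq_zero_iff_of_nonneg
    (fun s => by positivity) (F.squareIntegrable g).integrable_norm_sq] at h3
  change ∀ᵐ s : ℝ≥0 ∂F.D.m, _
  filter_upwards [h3, hg] with s hs1 hs2 hs
  have hsω : ω < s := by
    by_contra hcon
    exact hs ⟨s.2, not_lt.1 hcon⟩
  rw [hs2] at hs1
  simpa [hφ, hsω] using hs1

end SpectralFourierTransform

end

/-! ### Cyclic decomposition of representations of `C(X)`. -/

noncomputable section

namespace ContinuousMapRep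

open scoped CompactlySupported

variable {X : Type*} [TopologicalSpace X]
variable {H : Type*} [NormedAddCommGroup H] [InnerProductSpace ℂ H] [CompleteSpace H]
variable (Φ : C(X, ℂ) →⋆ₐ[ℂ] (H →L[ℂ] H))

/-- A real continuous function, considered as a complex one. -/
def ofRealMap (f : C(X, ℝ)) : C(X, ℂ) := ⟨fun x => (f x : ℂ), by fun_prop⟩

theorem inner_apply_left (k : C(X, ℂ)) (x y : H) : ⟪Φ k x, y⟫_ℂ = ⟪x, Φ (star k) y⟫_ℂ := by
  rw [map_star, ContinuousLinearMap.star_eq_adjoint, ContinuousLinearMap.adjoint_inner_right]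

theorem inner_apply_apply (k l : C(X, ℂ)) (x y : H) :
    ⟪Φ k x, Φ l y⟫_ℂ = ⟪x, Φ (star k * l) y⟫_ℂ := by
  rw [inner_apply_left, map_mul]
  rfl

/-- Evaluation of the functional calculus at a vector. -/
def evalVec (x : H) : C(X, ℂ) →ₗ[ℂ] H where
  toFun k := Φ k x
  map_add' k l := by simp
  map_smul' c k := by simp

section Subspaces

variable (x : ℕ → H)

/-- The closed invariant subspace generated by the first `n` vectors of a sequence. -/
def genSubspace (n : ℕ) : Submodule ℂ H :=
  (⨆ i : Fin n, LinearMap.range (evalVec Φ (x i))).topologicalClosure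

theorem apply_mem_genSubspace {i n : ℕ} (h : i < n) (k : C(X, ℂ)) :
    Φ k (x i) ∈ genSubspace Φ x n := by
  refine Submodule.le_topologicalClosure _ ?_
  exact (le_iSup (fun i : Fin n => LinearMap.range (evalVec Φ (x i))) ⟨i, h⟩) ⟨k, rfl⟩

theorem genSubspace_le {n : ℕ} {W : Submodule ℂ H} (hW : IsClosed (W : Set H))
    (h : ∀ i < n, ∀ k, Φ k (x i) ∈ W) : genSubspace Φ x n ≤ W := by
  refine Submodule.topologicalClosure_minimal _ (iSup_le fun i => ?_) hW
  rintro _ ⟨k, rfl⟩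
  exact h i i.2 k

theorem isClosed_genSubspace (n : ℕ) : IsClosed (genSubspace Φ x n : Set H) :=
  Submodule.isClosed_topologicalClosure _

theorem genSubspace_mono {n m : ℕ} (h : n ≤ m) : genSubspace Φ x n ≤ genSubspace Φ x m :=
  genSubspace_le Φ x (isClosed_genSubspace Φ x m) fun _ hi k =>
    apply_mem_genSubspace Φ x (hi.trans_le h) k

theorem apply_mem_of_mem_genSubspace {n : ℕ} (k : C(X, ℂ)) {y : H} (hy : y ∈ genSubspace Φ x n) :
    Φ k y ∈ genSubspace Φ x n := by
  have hle : genSubspace Φ x n ≤ (genSubspace Φ x n).comap (Φ k).toLinearMap := by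
    refine genSubspace_le Φ x ((isClosed_genSubspace Φ x n).preimage (Φ k).continuous) ?_
    intro i hi l
    change Φ k (Φ l (x i)) ∈ genSubspace Φ x n
    have h := apply_mem_genSubspace Φ x hi (k * l)
    rw [map_mul] at h
    exact h
  exact hle hy

instance (n : ℕ) : CompleteSpace (genSubspace Φ x n) :=
  (isClosed_genSubspace Φ x n).completeSpace_coe

/-- The sequence obtained from `x` by subtracting from `x n` its projection to the invariant
subspace generated by the previous vectors. -/
def orthVec (n : ℕ) : H := x n - (genSubspace Φ x n).starProjection (x n)

theorem orthVec_mem_orthogonal (n : ℕ) : orthVec Φ x n ∈ (genSubspace Φ x n)ᗮ :=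
  Submodule.sub_starProjection_mem_orthogonal _

theorem orthVec_mem {n m : ℕ} (h : n < m) : orthVec Φ x n ∈ genSubspace Φ x m := by
  refine Submodule.sub_mem (genSubspace Φ x m) ?_ (genSubspace_mono Φ x h.le (Submodule.starProjection_apply_mem _ _))
  simpa using apply_mem_genSubspace Φ x h 1

end Subspaces

variable [CompactSpace X]

/-- The positive functional `f ↦ ⟪x, Φ f x⟫` attached to a vector. -/
def vectorFunctional (x : H) : C_c(X, ℝ) →ₚ[ℝ] ℝ :=
  PositiveLinearMap.mk₀
    { toFun := fun f => (⟪x, Φ (ofRealMap f.toContinuousMap) x⟫_ℂ).re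
      map_add' := by
        intro f g
        have : ofRealMap (f + g).toContinuousMap =
            ofRealMap f.toContinuousMap + ofRealMap g.toContinuousMap := by
          ext t; simp [ofRealMap]
        rw [this, map_add, add_apply, inner_add_right, Complex.add_re]
      map_smul' := by
        intro c f
        have : ofRealMap (c • f).toContinuousMap = (c : ℂ) • ofRealMap f.toContinuousMap := by
          ext t; simp [ofRealMap]
        rw [this, map_smul, smul_apply, inner_smul_right]
        simp }
    (by
      intro f hf
      -- Positivity: with `f = √f · √f` the functional takes the value `‖Φ(√f) x‖²`.
      have hs : ofRealMap f.toContinuousMap =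
          star (ofRealMap ⟨fun t => √(f t), by fun_prop⟩) *
            ofRealMap ⟨fun t => √(f t), by fun_prop⟩ := by
        ext t
        have h0 : 0 ≤ f t := hf t
        simp [ofRealMap, ← Complex.ofReal_mul, Real.mul_self_sqrt h0]
      simp only [LinearMap.coe_mk, AddHom.coe_mk]
      rw [hs, ← inner_apply_apply]
      exact inner_self_nonneg (𝕜 := ℂ))

variable [T2Space X] [MeasurableSpace X] [BorelSpace X]

/-- The spectral measure of a vector. -/
def vectorMeasure (x : H) : Measure X := RealRMK.rieszMeasure (vectorFunctional Φ x)

instance (x : H) : (vectorMeasure Φ x).Regular := by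
  unfold vectorMeasure
  infer_instance

instance (x : H) : IsFiniteMeasure (vectorMeasure Φ x) :=
  CompactSpace.isFiniteMeasure

/-- Both sides are the functional of `x` at `|k|²`, since `Φ` is a star homomorphism. This identity
makes the cyclic map isometric. -/
theorem norm_sq_apply_eq (k : C(X, ℂ)) (x : H) :
    ‖Φ k x‖ ^ 2 = ∫ t, ‖k t‖ ^ 2 ∂vectorMeasure Φ x := by
  have h1 := RealRMK.integral_rieszMeasure (vectorFunctional Φ x)
    ⟨⟨fun t => ‖k t‖ ^ 2, by fun_prop⟩, HasCompactSupport.of_compactSpace _⟩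
  rw [vectorMeasure]
  refine Eq.trans ?_ h1.symm
  change _ = (⟪x, Φ (ofRealMap ⟨fun t => ‖k t‖ ^ 2, by fun_prop⟩) x⟫_ℂ).re
  have h2 : ofRealMap ⟨fun t => ‖k t‖ ^ 2, by fun_prop⟩ = star k * k := by
    ext t
    simp [ofRealMap, Complex.conj_mul']
  rw [h2, ← inner_apply_apply]
  exact norm_sq_eq_re_inner (𝕜 := ℂ) _

theorem norm_toLp_eq (k : C(X, ℂ)) (x : H) :
    ‖ContinuousMap.toLp 2 (vectorMeasure Φ x) ℂ k‖ = ‖Φ k x‖ := by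
  rw [← sq_eq_sq₀ (norm_nonneg _) (norm_nonneg _), norm_sq_apply_eq,
    ← inner_self_eq_norm_sq (𝕜 := ℂ), ContinuousMap.inner_toLp]
  have h : ∀ t, k t * (starRingEnd ℂ) (k t) = ((‖k t‖ ^ 2 : ℝ) : ℂ) := fun t => by
    rw [Complex.mul_conj']; simp
  simp only [h]
  rw [integral_complex_ofReal]
  simp

theorem denseRange_toLp (x : H) :
    DenseRange (ContinuousMap.toLp 2 (vectorMeasure Φ x) ℂ : C(X, ℂ) →L[ℂ] _) :=
  ContinuousMap.toLp_denseRange ℂ (vectorMeasure Φ x) ℂ (by norm_num)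

/-- The isometry from `L²` of the spectral measure of `x` onto the closed cyclic subspace
generated by `x`, as a continuous linear map. -/
def cyclicMap (x : H) : Lp ℂ 2 (vectorMeasure Φ x) →L[ℂ] H :=
  (evalVec Φ x).extendOfNorm (ContinuousMap.toLp 2 (vectorMeasure Φ x) ℂ).toLinearMap

theorem cyclicMap_toLp (x : H) (k : C(X, ℂ)) :
    cyclicMap Φ x (ContinuousMap.toLp 2 (vectorMeasure Φ x) ℂ k) = Φ k x :=
  LinearMap.extendOfNorm_eq (f := evalVec Φ x)
    (e := (ContinuousMap.toLp 2 (vectorMeasure Φ x) ℂ).toLinearMap)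
    (denseRange_toLp Φ x) ⟨1, fun k => by
      rw [one_mul]; exact (norm_toLp_eq Φ k x).ge⟩ k

theorem norm_cyclicMap (x : H) (f : Lp ℂ 2 (vectorMeasure Φ x)) : ‖cyclicMap Φ x f‖ = ‖f‖ := by
  refine (denseRange_toLp Φ x).induction_on f ?_ fun k => ?_
  · exact isClosed_eq (cyclicMap Φ x).continuous.norm continuous_norm
  · rw [cyclicMap_toLp, norm_toLp_eq]

/-- The isometry from `L²` of the spectral measure of `x` onto the closed cyclic subspace
generated by `x`. -/
def cyclicIsometry (x : H) : Lp ℂ 2 (vectorMeasure Φ x) →ₗᵢ[ℂ] H :=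
  ⟨(cyclicMap Φ x).toLinearMap, norm_cyclicMap Φ x⟩

theorem cyclicIsometry_toLp (x : H) (k : C(X, ℂ)) :
    cyclicIsometry Φ x (ContinuousMap.toLp 2 (vectorMeasure Φ x) ℂ k) = Φ k x :=
  cyclicMap_toLp Φ x k

/-- The isometry intertwines multiplication operators with the representation. -/
theorem apply_cyclicIsometry (x : H) (k : C(X, ℂ)) (f : Lp ℂ 2 (vectorMeasure Φ x)) :
    ∃ f' : Lp ℂ 2 (vectorMeasure Φ x), (f' =ᵐ[vectorMeasure Φ x] fun t => k t * f t) ∧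
      Φ k (cyclicIsometry Φ x f) = cyclicIsometry Φ x f' := by
  set M := (ContinuousLinearMap.mul ℂ ℂ).holderL (vectorMeasure Φ x) ∞ 2 2
    (ContinuousMap.toLp ∞ (vectorMeasure Φ x) ℂ k) with hM
  have hMf : ∀ f, M f =ᵐ[vectorMeasure Φ x] fun t => k t * f t := by
    intro f
    filter_upwards [ContinuousLinearMap.coeFn_holder (r := 2) (ContinuousLinearMap.mul ℂ ℂ)
      (ContinuousMap.toLp ∞ (vectorMeasure Φ x) ℂ k) f,
      ContinuousMap.coeFn_toLp (p := ∞) (𝕜 := ℂ) (vectorMeasure Φ x) k] with t h1 h2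
    rw [h2] at h1
    exact h1
  refine ⟨M f, hMf f, ?_⟩
  refine (denseRange_toLp Φ x).induction_on f ?_ fun l => ?_
  · exact isClosed_eq ((Φ k).continuous.comp (cyclicIsometry Φ x).continuous)
      ((cyclicIsometry Φ x).continuous.comp M.continuous)
  · have : M (ContinuousMap.toLp 2 (vectorMeasure Φ x) ℂ l) =
        ContinuousMap.toLp 2 (vectorMeasure Φ x) ℂ (k * l) := by
      apply Lp.ext
      filter_upwards [hMf (ContinuousMap.toLp 2 (vectorMeasure Φ x) ℂ l),
        ContinuousMap.coeFn_toLp (p := 2) (𝕜 := ℂ) (vectorMeasure Φ x) l,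
        ContinuousMap.coeFn_toLp (p := 2) (𝕜 := ℂ) (vectorMeasure Φ x) (k * l)] with t h1 h2 h3
      rw [h1, h2, h3, ContinuousMap.mul_apply]
    rw [this, cyclicIsometry_toLp, cyclicIsometry_toLp, map_mul]
    rfl

theorem cyclicIsometry_mem {W : Submodule ℂ H} (hW : IsClosed (W : Set H)) {y : H}
    (h : ∀ k, Φ k y ∈ W) (f : Lp ℂ 2 (vectorMeasure Φ y)) : cyclicIsometry Φ y f ∈ W := by
  refine (denseRange_toLp Φ y).induction_on f ?_ fun k => ?_
  · exact hW.preimage (cyclicIsometry Φ y).continuous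
  · rw [cyclicIsometry_toLp]
    exact h k

variable (x : ℕ → H)

/-- For `i < j` the cyclic space of the `i`-th vector lies in the invariant subspace to which the
`j`-th vector is orthogonal. The orthogonal complement of that subspace is invariant too, because
`Φ` respects adjoints. -/
theorem orthogonalFamily_cyclicIsometry :
    OrthogonalFamily ℂ (fun n => Lp ℂ 2 (vectorMeasure Φ (orthVec Φ x n)))
      fun n => cyclicIsometry Φ (orthVec Φ x n) := by
  have key : ∀ {i j : ℕ}, i < j → ∀ f g,
      ⟪cyclicIsometry Φ (orthVec Φ x i) f, cyclicIsometry Φ (orthVec Φ x j) g⟫_ℂ = 0 := by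
    intro i j hij f g
    have hf : cyclicIsometry Φ (orthVec Φ x i) f ∈ genSubspace Φ x j :=
      cyclicIsometry_mem Φ (isClosed_genSubspace Φ x j)
        (fun k => apply_mem_of_mem_genSubspace Φ x k (orthVec_mem Φ x hij)) f
    have hg : cyclicIsometry Φ (orthVec Φ x j) g ∈ (genSubspace Φ x j)ᗮ := by
      refine cyclicIsometry_mem Φ (Submodule.isClosed_orthogonal _) (fun k => ?_) g
      intro z hz
      rw [← star_star k, ← inner_apply_left]
      exact orthVec_mem_orthogonal Φ x j _ (apply_mem_of_mem_genSubspace Φ x _ hz)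
    exact hg _ hf
  intro i j hij f g
  rcases lt_or_gt_of_ne hij with h | h
  · exact key h f g
  · exact inner_eq_zero_symm.1 (key h g f)

/-- **Cyclic decomposition** of a representation of `C(X)` on a separable Hilbert space. -/
theorem isHilbertSum_cyclicIsometry (hx : Dense (Submodule.span ℂ (Set.range x) : Set H)) :
    IsHilbertSum ℂ (fun n => Lp ℂ 2 (vectorMeasure Φ (orthVec Φ x n)))
      fun n => cyclicIsometry Φ (orthVec Φ x n) := by
  refine IsHilbertSum.mk (orthogonalFamily_cyclicIsometry Φ x) ?_
  set W := (⨆ n, LinearMap.range (cyclicIsometry Φ (orthVec Φ x n)).toLinearMap).topologicalClosure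
    with hWdef
  have hW : IsClosed (W : Set H) := Submodule.isClosed_topologicalClosure _
  have hmem : ∀ n f, cyclicIsometry Φ (orthVec Φ x n) f ∈ W := fun n f =>
    Submodule.le_topologicalClosure _ (le_iSup (fun n => LinearMap.range
      (cyclicIsometry Φ (orthVec Φ x n)).toLinearMap) n ⟨f, rfl⟩)
  have hinv : ∀ k, W ≤ W.comap (Φ k).toLinearMap := by
    intro k
    refine Submodule.topologicalClosure_minimal _ (iSup_le fun n => ?_)
      (hW.preimage (Φ k).continuous)
    rintro _ ⟨f, rfl⟩
    obtain ⟨f', -, hf'⟩ := apply_cyclicIsometry Φ (orthVec Φ x n) k f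
    change Φ k (cyclicIsometry Φ (orthVec Φ x n) f) ∈ W
    rw [hf']
    exact hmem n f'
  -- Each `x n` is its orthogonalized vector plus a projection into the invariant subspace generated
  -- by earlier terms, hence strong induction.
  have hxn : ∀ n, x n ∈ W := by
    intro n
    induction n using Nat.strong_induction_on with
    | _ n ih =>
      have h1 : genSubspace Φ x n ≤ W := genSubspace_le Φ x hW fun i hi k => hinv k (ih i hi)
      have h2 : orthVec Φ x n ∈ W := by
        have := hmem n (ContinuousMap.toLp 2 (vectorMeasure Φ (orthVec Φ x n)) ℂ 1)
        rw [cyclicIsometry_toLp, map_one] at this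
        exact this
      have h3 : x n = orthVec Φ x n + (genSubspace Φ x n).starProjection (x n) := by
        rw [orthVec, sub_add_cancel]
      rw [h3]
      exact W.add_mem h2 (h1 (Submodule.starProjection_apply_mem _ _))
  have h4 : (Submodule.span ℂ (Set.range x)).topologicalClosure ≤ W :=
    Submodule.topologicalClosure_minimal _
      (Submodule.span_le.2 (Set.range_subset_iff.2 hxn)) hW
  rwa [Submodule.dense_iff_topologicalClosure_eq_top.1 hx] at h4

end ContinuousMapRep

end

/-! ### Multiplication form of a positive injective contraction. -/

noncomputable section

/-- The point `1 / z - 1` of the half-line, for `z` in `(0, 1]`. -/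
def invSubOne (z : ℂ) : ℝ≥0 := (z.re⁻¹ - 1).toNNReal

theorem measurable_invSubOne : Measurable invSubOne :=
  ((Complex.measurable_re.inv).sub_const 1).real_toNNReal

theorem inv_one_add_invSubOne {r : ℝ} (h0 : 0 < r) (h1 : r ≤ 1) :
    ((1 : ℂ) + ((invSubOne r : ℝ≥0) : ℝ))⁻¹ = r := by
  have h : 0 ≤ r⁻¹ - 1 := sub_nonneg.2 ((one_le_inv₀ h0).2 h1)
  rw [invSubOne, Complex.ofReal_re, Real.coe_toNNReal _ h]
  push_cast
  rw [add_sub_cancel, inv_inv]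

theorem norm_inv_one_add_le (s : ℝ≥0) : ‖((1 : ℂ) + (s : ℝ))⁻¹‖ ≤ 1 := by
  have h : (1 : ℂ) + (s : ℝ) = ((1 + s : ℝ) : ℂ) := by push_cast; rfl
  rw [h, norm_inv, Complex.norm_real, Real.norm_of_nonneg (by positivity)]
  exact inv_le_one_of_one_le₀ (by simp)

/-- The left inverse `ψ` acts on functions rather than points: in the application `1 / (1 + s)` may
leave the spectrum, and functions are extended by zero there. -/
theorem surjective_compMeasurePreserving_of_leftInverse {α β : Type*} [MeasurableSpace α] [MeasurableSpace β]
    {μ : Measure α} {p : ℝ≥0∞} [Fact (1 ≤ p)] {φ : α → β} (hφ : Measurable φ) {ψ : (α → ℂ) → β → ℂ}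
    (hψ : ∀ f, Measurable f → Measurable (ψ f))
    (h : ∀ f, ∀ᵐ x ∂μ, ψ f (φ x) = f x) :
    Function.Surjective (Lp.compMeasurePreservingₗᵢ (E := ℂ) (p := p) ℂ φ
      (hφ.measurePreserving μ)) := by
  intro f
  have hm : Measurable (ψ f) := hψ f (Lp.stronglyMeasurable f).measurable
  have hmem : MemLp (ψ f) p (μ.map φ) := by
    rw [memLp_map_measure_iff hm.aestronglyMeasurable hφ.aemeasurable]
    exact (memLp_congr_ae (h f)).2 (Lp.memLp f)
  refine ⟨hmem.toLp _, ?_⟩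
  apply Lp.ext
  refine (Lp.coeFn_compMeasurePreserving _ (hφ.measurePreserving μ)).trans ?_
  filter_upwards [h f, (hφ.measurePreserving μ).quasiMeasurePreserving.ae hmem.coeFn_toLp]
    with x h1 h2
  simp only [Function.comp_apply, h2, h1]

section Resolvent

variable {H : Type*} [NormedAddCommGroup H] [InnerProductSpace ℂ H] [CompleteSpace H]

/-- The coordinates of a Hilbert sum of `L²` spaces, under an operator that acts as a bounded
multiplication operator on each summand. -/
theorem IsHilbertSum.linearIsometryEquiv_apply_of_mul {α : Type*} [MeasurableSpace α]
    {ν : ℕ → Measure α} {U : ∀ n, Lp ℂ 2 (ν n) →ₗᵢ[ℂ] H}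
    (hU : IsHilbertSum ℂ (fun n => Lp ℂ 2 (ν n)) U) (R : H →L[ℂ] H) {φ : α → ℂ}
    (hφ : ∀ a, ‖φ a‖ ≤ 1)
    (hR : ∀ n g, ∃ g' : Lp ℂ 2 (ν n), (g' =ᵐ[ν n] fun a => φ a * g a) ∧ R (U n g) = U n g')
    (f : H) (n : ℕ) :
    hU.linearIsometryEquiv (R f) n =ᵐ[ν n] fun a => φ a * hU.linearIsometryEquiv f n a := by
  choose M hM hRM using hR
  set w := hU.linearIsometryEquiv f with hw
  -- The bound on `φ` makes every coordinate operator a contraction, so the multiplied coordinates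
  -- are again square-summable.
  have hle : ∀ n, ‖M n (w n)‖ ≤ ‖w n‖ := by
    intro n
    refine Lp.norm_le_norm_of_ae_le ?_
    filter_upwards [hM n (w n)] with a ha
    rw [ha, norm_mul]
    exact mul_le_of_le_one_left (norm_nonneg _) (hφ a)
  have hmem : Memℓp (fun n => M n (w n)) 2 := by
    refine memℓp_gen ?_
    refine Summable.of_nonneg_of_le (fun n => by positivity) (fun n => ?_)
      ((lp.memℓp w).summable (by norm_num))
    gcongr
    exact hle n
  have h1 := hU.hasSum_linearIsometryEquiv_symm w
  have h2 := hU.hasSum_linearIsometryEquiv_symm (⟨_, hmem⟩ : lp (fun n => Lp ℂ 2 (ν n)) 2)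
  have h3 := R.hasSum h1
  rw [hw, LinearIsometryEquiv.symm_apply_apply] at h3
  have h4 : ∀ i, R (U i (w i)) = U i (M i (w i)) := fun i => hRM i (w i)
  have h5 : R f = hU.linearIsometryEquiv.symm ⟨_, hmem⟩ := by
    refine h3.unique ?_
    simp only [← hw, h4]
    exact h2
  rw [h5, LinearIsometryEquiv.apply_symm_apply]
  exact hM n (w n)

/-- A positive injective contraction on a separable Hilbert space is unitarily equivalent to
multiplication by `1 / (1 + s)` on a countable sum of spaces `L²([0, ∞), ν n)`. -/
theorem exists_isHilbertSum_of_isPositive (R : H →L[ℂ] H) (hpos : R.IsPositive) (hnorm : ‖R‖ ≤ 1)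
    (hinj : ∀ f, R f = 0 → f = 0) (x : ℕ → H)
    (hx : Dense (Submodule.span ℂ (Set.range x) : Set H)) :
    ∃ (ν : ℕ → Measure ℝ≥0) (_ : ∀ n, IsFiniteMeasure (ν n))
      (W : H ≃ₗᵢ[ℂ] lp (fun n => Lp ℂ 2 (ν n)) 2),
      ∀ f n, W (R f) n =ᵐ[ν n] fun s => ((1 : ℂ) + (s : ℝ))⁻¹ * W f n s := by
  have hsa : IsSelfAdjoint R := hpos.isSelfAdjoint
  have hn : IsStarNormal R := hsa.isStarNormal
  set Φ := cfcHom (R := ℂ) hn with hΦ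
  set k : C(spectrum ℂ R, ℂ) := (ContinuousMap.id ℂ).restrict (spectrum ℂ R) with hk
  have hΦk : Φ k = R := cfcHom_id hn
  have hspec : ∀ z ∈ spectrum ℂ R, z ≠ 0 → ∃ r : ℝ, 0 < r ∧ r ≤ 1 ∧ z = r := by
    intro z hz hz0
    have hre : z = z.re := hsa.mem_spectrum_eq_re hz
    have h0 : 0 ≤ z.re := by
      have h1 : (0 : H →L[ℂ] H) ≤ R := (ContinuousLinearMap.nonneg_iff_isPositive R).2 hpos
      have h2 : z.re ∈ spectrum ℝ R := by
        rw [hre] at hz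
        exact (spectrum.algebraMap_mem_iff ℂ).1 hz
      exact spectrum_nonneg_of_nonneg h1 h2
    refine ⟨z.re, lt_of_le_of_ne h0 fun h => hz0 ?_, ?_, hre⟩
    · rw [hre, ← h, Complex.ofReal_zero]
    · have h3 := spectrum.norm_le_norm_mul_of_mem hz
      have h4 : ‖(1 : H →L[ℂ] H)‖ ≤ 1 := ContinuousLinearMap.norm_id_le
      exact (Complex.re_le_norm z).trans (h3.trans (mul_le_one₀ hnorm (norm_nonneg _) h4))
  set y := ContinuousMapRep.orthVec Φ x with hy
  set μ := fun n => ContinuousMapRep.vectorMeasure Φ (y n) with hμ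
  set V := fun n => ContinuousMapRep.cyclicIsometry Φ (y n) with hV
  have hsum : IsHilbertSum ℂ (fun n => Lp ℂ 2 (μ n)) V :=
    ContinuousMapRep.isHilbertSum_cyclicIsometry Φ x hx
  have hRV : ∀ n f, ∃ f' : Lp ℂ 2 (μ n), (f' =ᵐ[μ n] fun t => (t : ℂ) * f t) ∧
      R (V n f) = V n f' := by
    intro n f
    obtain ⟨f', h1, h2⟩ := ContinuousMapRep.apply_cyclicIsometry Φ (y n) k f
    rw [hΦk] at h2
    exact ⟨f', h1, h2⟩
  -- No spectral measure charges zero: the indicator of `{0}` is sent into the kernel of `R`, which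
  -- is trivial. This permits the substitution `s = 1 / z - 1`.
  have hμ0 : ∀ n, ∀ᵐ t : spectrum ℂ R ∂μ n, (t : ℂ) ≠ 0 := by
    intro n
    set S : Set (spectrum ℂ R) := {t | (t : ℂ) = 0} with hS
    have hSm : MeasurableSet S := measurable_subtype_coe (measurableSet_singleton (0 : ℂ))
    obtain ⟨f', h1, h2⟩ := hRV n (indicatorConstLp 2 hSm (measure_ne_top (μ n) S) (1 : ℂ))
    have h3 : f' = 0 := by
      apply Lp.ext
      filter_upwards [h1, indicatorConstLp_coeFn (p := 2) (hs := hSm)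
        (hμs := measure_ne_top (μ n) S) (c := (1 : ℂ)), Lp.coeFn_zero ℂ 2 (μ n)] with t h4 h5 h6
      rw [h4, h5, h6]
      by_cases ht : t ∈ S
      · have : (t : ℂ) = 0 := ht
        simp [this]
      · simp [ht]
    rw [h3, map_zero] at h2
    have h4 := hinj _ h2
    rw [map_eq_zero_iff _ (V n).injective] at h4
    have h5 := indicatorConstLp_coeFn_mem (p := 2) (hs := hSm)
      (hμs := measure_ne_top (μ n) S) (c := (1 : ℂ))
    rw [h4] at h5
    filter_upwards [h5, Lp.coeFn_zero ℂ 2 (μ n)] with t h6 h7 ht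
    rw [h7] at h6
    exact zero_ne_one (h6 ht)
  set φ : spectrum ℂ R → ℝ≥0 := fun t => invSubOne t with hφ
  have hφm : Measurable φ := measurable_invSubOne.comp measurable_subtype_coe
  have hφψ : ∀ t : spectrum ℂ R, (t : ℂ) ≠ 0 → ((1 : ℂ) + ((φ t : ℝ≥0) : ℝ))⁻¹ = t := by
    intro t ht
    obtain ⟨r, h0, h1, h2⟩ := hspec t t.2 ht
    simp only [hφ]
    rw [h2]
    exact inv_one_add_invSubOne h0 h1
  set P := fun n => Lp.compMeasurePreservingₗᵢ (E := ℂ) (p := 2) ℂ φ (hφm.measurePreserving (μ n))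
    with hP
  have hPsurj : ∀ n, Function.Surjective (P n) := by
    intro n
    have hemb : MeasurableEmbedding (Subtype.val : spectrum ℂ R → ℂ) :=
      MeasurableEmbedding.subtype_coe (spectrum.isClosed R).measurableSet
    refine surjective_compMeasurePreserving_of_leftInverse (μ := μ n) hφm
      (ψ := fun f s => Function.extend Subtype.val f 0 ((1 : ℂ) + (s : ℝ))⁻¹) ?_ ?_
    · intro f hf
      refine (hemb.measurable_extend hf measurable_zero).comp ?_
      fun_prop
    · intro f
      filter_upwards [hμ0 n] with t ht
      simp only [hφψ t ht]
      exact Subtype.val_injective.extend_apply _ _ _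
  -- Transport to the half-line is onto in each summand, so the ranges, and with them totality, are
  -- unchanged.
  have hUsum : IsHilbertSum ℂ (fun n => Lp ℂ 2 ((μ n).map φ)) fun n => (V n).comp (P n) := by
    refine IsHilbertSum.mk (fun i j hij f g => hsum.OrthogonalFamily hij _ _) ?_
    have h1 : ∀ n, LinearMap.range ((V n).comp (P n)).toLinearMap =
        LinearMap.range (V n).toLinearMap := by
      intro n
      apply SetLike.coe_injective
      exact (hPsurj n).range_comp (V n)
    have h2 : (fun n => LinearMap.range ((V n).comp (P n)).toLinearMap) =
        fun n => LinearMap.range (V n).toLinearMap := funext h1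
    rw [h2]
    have h3 := hsum.OrthogonalFamily.range_linearIsometry
    rw [← h3, ← LinearMap.range_eq_top.2 hsum.surjective_isometry]
  refine ⟨fun n => (μ n).map φ, fun n => inferInstance, hUsum.linearIsometryEquiv, ?_⟩
  refine hUsum.linearIsometryEquiv_apply_of_mul R norm_inv_one_add_le ?_
  intro n g
  obtain ⟨f', h1, h2⟩ := hRV n (P n g)
  obtain ⟨g', rfl⟩ := hPsurj n f'
  refine ⟨g', ?_, h2⟩
  have h3 : ∀ᵐ t ∂μ n, g' (φ t) = ((1 : ℂ) + ((φ t : ℝ≥0) : ℝ))⁻¹ * g (φ t) := by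
    filter_upwards [hμ0 n, h1, Lp.coeFn_compMeasurePreserving g (hφm.measurePreserving (μ n)),
      Lp.coeFn_compMeasurePreserving g' (hφm.measurePreserving (μ n))] with t h4 h5 h6 h7
    rw [hφψ t h4]
    have h8 : (P n g') t = g' (φ t) := h7
    have h9 : (P n g) t = g (φ t) := h6
    rw [← h8, ← h9]
    exact h5
  refine (ae_map_iff hφm.aemeasurable ?_).2 h3
  exact measurableSet_eq_fun (Lp.stronglyMeasurable g').measurable
    (Measurable.mul (by fun_prop) (Lp.stronglyMeasurable g).measurable)

end Resolvent

end

/-! ### From countable sums of `L²` spaces to direct integrals and spectral transforms. -/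

noncomputable section

theorem lp.tsum_enorm_sq {ι : Type*} {E : ι → Type*} [∀ i, NormedAddCommGroup (E i)]
    (f : lp E 2) : ∑' i, ‖f i‖ₑ ^ 2 = ‖f‖ₑ ^ 2 := by
  have h := lp.hasSum_norm (p := 2) (by norm_num) f
  simp only [ENNReal.toReal_ofNat, Real.rpow_ofNat] at h
  have h1 : ∀ {F : Type _} [NormedAddCommGroup F] (y : F), ‖y‖ₑ ^ 2 = ENNReal.ofReal (‖y‖ ^ 2) := by
    intro F _ y
    rw [ENNReal.ofReal_pow (norm_nonneg _), ofReal_norm]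
  rw [h1 f, ← h.tsum_eq, ENNReal.ofReal_tsum_of_nonneg (fun i => by positivity) h.summable]
  exact tsum_congr fun i => by rw [ENNReal.ofReal_pow (norm_nonneg _), ofReal_norm]

theorem memℓp_two_of_tsum_enorm_sq {ι : Type*} {E : ι → Type*} [∀ i, NormedAddCommGroup (E i)]
    {f : ∀ i, E i} (h : ∑' i, ‖f i‖ₑ ^ 2 ≠ ∞) : Memℓp f 2 := by
  refine memℓp_gen ?_
  have := ENNReal.summable_toReal h
  simpa using this

theorem MeasureTheory.Lp.lintegral_enorm_sq {α : Type*} [MeasurableSpace α] {μ : Measure α}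
    (f : Lp ℂ 2 μ) : ∫⁻ a, ‖f a‖ₑ ^ 2 ∂μ = ‖f‖ₑ ^ 2 := by
  rw [Lp.enorm_def, eLpNorm_eq_lintegral_rpow_enorm_toReal (by norm_num) (by norm_num)]
  simp only [ENNReal.toReal_ofNat, ENNReal.rpow_ofNat, one_div]
  rw [← ENNReal.rpow_natCast, ← ENNReal.rpow_mul]
  simp

/-- Countably many finite measures have densities with respect to a common finite measure. -/
theorem exists_common_density {α : Type*} [MeasurableSpace α] (ν : ℕ → Measure α)
    [∀ n, IsFiniteMeasure (ν n)] :
    ∃ (m : Measure α) (_ : IsFiniteMeasure m) (r : ℕ → α → ℝ≥0),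
      (∀ n, Measurable (r n)) ∧ ∀ n, ν n = m.withDensity fun s => r n s := by
  -- The sum of the `ν n` need not be σ-finite, so it is replaced by an equivalent finite measure.
  -- Truncating the densities to finite values changes them only on a null set.
  refine ⟨(Measure.sum ν).toFinite, inferInstance,
    fun n s => ((ν n).rnDeriv (Measure.sum ν).toFinite s).toNNReal,
    fun n => (Measure.measurable_rnDeriv _ _).ennreal_toNNReal, fun n => ?_⟩
  have hac : ν n ≪ (Measure.sum ν).toFinite :=
    (Measure.absolutelyContinuous_of_le (Measure.le_sum ν n)).trans
      (absolutelyContinuous_toFinite _)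
  have h1 := Measure.withDensity_rnDeriv_eq (ν n) _ hac
  conv_lhs => rw [← h1]
  refine withDensity_congr_ae ?_
  filter_upwards [Measure.rnDeriv_lt_top (ν n) (Measure.sum ν).toFinite] with s hs
  rw [ENNReal.coe_toNNReal hs.ne]

namespace DiagField

variable (r : ℕ → ℝ≥0 → ℝ≥0)

/-- The fibre at `s`: square-summable sequences indexed by those `n` with `r n s ≠ 0`. -/
abbrev Fibre (s : ℝ≥0) : Type := lp (fun _ : {n : ℕ // r n s ≠ 0} => ℂ) 2

/-- The coordinate vector fields, set to zero where the coordinate is absent. -/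
def coordVec (n : ℕ) (s : ℝ≥0) : Fibre r s :=
  if h : r n s ≠ 0 then lp.single 2 ⟨n, h⟩ 1 else 0

theorem inner_coordVec_of_ne {n : ℕ} {s : ℝ≥0} (h : r n s ≠ 0) (a : Fibre r s) :
    ⟪coordVec r n s, a⟫_ℂ = a ⟨n, h⟩ := by
  rw [coordVec, dif_pos h, lp.inner_single_left]
  simp

theorem inner_coordVec_of_eq {n : ℕ} {s : ℝ≥0} (h : r n s = 0) (a : Fibre r s) :
    ⟪coordVec r n s, a⟫_ℂ = 0 := by
  rw [coordVec, dif_neg (by simpa using h), inner_zero_left]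

theorem inner_coordVec_coordVec (i j : ℕ) (s : ℝ≥0) :
    ⟪coordVec r i s, coordVec r j s⟫_ℂ = if i = j ∧ r i s ≠ 0 then 1 else 0 := by
  by_cases hi : r i s = 0
  · rw [inner_coordVec_of_eq r hi]
    simp [hi]
  · rw [inner_coordVec_of_ne r hi, coordVec]
    by_cases hj : r j s = 0
    · have hij : i ≠ j := by rintro rfl; exact hi hj
      simp [hj, hij]
    · rw [dif_pos hj]
      by_cases hij : i = j
      · subst hij
        simp [hi]
      · rw [lp.single_apply_ne]
        · simp [hij]
        · simpa using hij

theorem dense_span_coordVec (s : ℝ≥0) :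
    Dense (Submodule.span ℂ (Set.range fun n => coordVec r n s) : Set (Fibre r s)) := by
  intro a
  have h := lp.hasSum_single (p := 2) (by norm_num) a
  refine mem_closure_of_tendsto h (Filter.Eventually.of_forall fun S => ?_)
  refine Submodule.sum_mem _ fun i _ => ?_
  have h1 : lp.single 2 i (a i) = a i • coordVec r i s := by
    rw [coordVec, dif_pos i.2, ← lp.single_smul, smul_eq_mul, mul_one]
  rw [h1]
  exact Submodule.smul_mem _ _ (Submodule.subset_span ⟨i, rfl⟩)

theorem tsum_inner_coordVec (s : ℝ≥0) (a : Fibre r s) :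
    ∑' n, ‖⟪coordVec r n s, a⟫_ℂ‖ₑ ^ 2 = ‖a‖ₑ ^ 2 := by
  rw [← lp.tsum_enorm_sq a]
  have h1 : ∀ i : {n : ℕ // r n s ≠ 0}, ‖a i‖ₑ ^ 2 = ‖⟪coordVec r i s, a⟫_ℂ‖ₑ ^ 2 := fun i => by
    rw [inner_coordVec_of_ne r i.2]
  simp only [h1]
  refine (tsum_subtype_eq_of_support_subset (s := {n | r n s ≠ 0})
    (f := fun n => ‖⟪coordVec r n s, a⟫_ℂ‖ₑ ^ 2) ?_).symm
  intro n hn hcon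
  exact hn (by simp [inner_coordVec_of_eq r hcon])

theorem ext_inner_coordVec {s : ℝ≥0} {a b : Fibre r s}
    (h : ∀ n, ⟪coordVec r n s, a⟫_ℂ = ⟪coordVec r n s, b⟫_ℂ) : a = b := by
  apply lp.ext
  funext i
  have := h i
  rwa [inner_coordVec_of_ne r i.2, inner_coordVec_of_ne r i.2] at this

open Classical in
/-- The section with given coordinates, set to zero where they are not square-summable. -/
def ofCoords (c : ℕ → ℝ≥0 → ℂ) (s : ℝ≥0) : Fibre r s :=
  if h : Memℓp (fun n : {n : ℕ // r n s ≠ 0} => c n s) 2 then ⟨_, h⟩ else 0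

theorem inner_ofCoords {c : ℕ → ℝ≥0 → ℂ} {s : ℝ≥0} (h : ∑' n, ‖c n s‖ₑ ^ 2 ≠ ∞)
    (h0 : ∀ n, r n s = 0 → c n s = 0) (n : ℕ) : ⟪coordVec r n s, ofCoords r c s⟫_ℂ = c n s := by
  by_cases hn : r n s = 0
  · rw [inner_coordVec_of_eq r hn, h0 n hn]
  · have hmem : Memℓp (fun n : {n : ℕ // r n s ≠ 0} => c n s) 2 :=
      memℓp_two_of_tsum_enorm_sq (ne_top_of_le_ne_top h
        (ENNReal.tsum_comp_le_tsum_of_injective Subtype.val_injective fun n => ‖c n s‖ₑ ^ 2))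
    rw [inner_coordVec_of_ne r hn, ofCoords, dif_pos hmem]

variable {r}

/-- The field of Hilbert spaces with fibres `Fibre r s`. -/
def field (m : Measure ℝ≥0) [IsFiniteMeasure m] (hr : ∀ n, Measurable (r n)) : HilbertField where
  m := m
  sigmaFinite := inferInstance
  A := Fibre r
  normed _ := inferInstance
  innerProd _ := inferInstance
  complete _ := inferInstance
  e := coordVec r
  measurable_inner i j := by
    simp only [inner_coordVec_coordVec]
    refine Measurable.ite ?_ measurable_const measurable_const
    by_cases hij : i = j
    · simpa [hij, Set.compl_def] using (hr j (measurableSet_singleton 0)).compl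
    · simp [hij]
  total := dense_span_coordVec r

end DiagField

open DiagField in
/-- A countable sum of spaces `L²([0, ∞), ν n)` is a direct integral. -/
theorem exists_directIntegral {H : Type*} [NormedAddCommGroup H] [InnerProductSpace ℂ H]
    (ν : ℕ → Measure ℝ≥0) [∀ n, IsFiniteMeasure (ν n)]
    (W : H ≃ₗᵢ[ℂ] lp (fun n => Lp ℂ 2 (ν n)) 2) :
    ∃ (D : HilbertField) (T : H → ∀ s, D.A s),
      (∀ f, D.SquareIntegrable (T f)) ∧
      (∀ f g, ∀ᵐ s ∂D.m, T (f + g) s = T f s + T g s) ∧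
      (∀ (c : ℂ) f, ∀ᵐ s ∂D.m, T (c • f) s = c • T f s) ∧
      (∀ f, ∫⁻ s, ‖T f s‖ₑ ^ 2 ∂D.m = ‖f‖ₑ ^ 2) ∧
      (∀ a, D.SquareIntegrable a → ∃ f, ∀ᵐ s ∂D.m, T f s = a s) ∧
      (∀ (f g : H) (φ : ℝ≥0 → ℂ), (∀ n, W g n =ᵐ[ν n] fun s => φ s * W f n s) →
        ∀ᵐ s ∂D.m, T g s = φ s • T f s) := by
  obtain ⟨m, hm, r, hr, hν⟩ := exists_common_density ν
  have hac : ∀ n, ν n ≪ m := fun n => by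
    rw [hν]; exact withDensity_absolutelyContinuous _ _
  -- A statement that holds `ν n`-a.e. holds `m`-a.e. where the density is nonzero, which is exactly
  -- where the `n`-th coordinate is present in the fibre.
  have hae : ∀ {p : ℕ → ℝ≥0 → Prop}, (∀ n, ∀ᵐ s ∂ν n, p n s) →
      ∀ᵐ s ∂m, ∀ n, r n s ≠ 0 → p n s := by
    intro p hp
    rw [ae_all_iff]
    intro n
    have h := hp n
    rw [hν, ae_withDensity_iff (hr n).coe_nnreal_ennreal] at h
    filter_upwards [h] with s hs hs0
    exact hs (by simpa using hs0)
  -- Multiplication by the square root of the density carries `L²(ν n)` isometrically into `L²(m)`.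
  set q : ℕ → ℝ≥0 → ℂ := fun n s => ((NNReal.sqrt (r n s) : ℝ≥0) : ℝ) with hq
  have hqm : ∀ n, Measurable (q n) := fun n => Complex.measurable_ofReal.comp
    (NNReal.continuous_sqrt.measurable.comp (hr n)).coe_nnreal_real
  have hq0 : ∀ n s, q n s = 0 ↔ r n s = 0 := by
    intro n s; simp [hq]
  have hqe : ∀ n s, ‖q n s‖ₑ ^ 2 = r n s := by
    intro n s
    have h1 : ‖q n s‖ₑ = (NNReal.sqrt (r n s) : ℝ≥0) := by
      rw [← ofReal_norm, hq, Complex.norm_real, Real.norm_of_nonneg (NNReal.coe_nonneg _),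
        ENNReal.ofReal_coe_nnreal]
    rw [h1, ← ENNReal.coe_pow, NNReal.sq_sqrt]
  set c : H → ℕ → ℝ≥0 → ℂ := fun f n s => q n s * W f n s with hc
  have hcm : ∀ f n, Measurable (c f n) := fun f n =>
    (hqm n).mul (Lp.stronglyMeasurable _).measurable
  have hc0 : ∀ f n s, r n s = 0 → c f n s = 0 := by
    intro f n s h
    simp [hc, (hq0 n s).2 h]
  have hdens : ∀ n (g : ℝ≥0 → ℂ), AEMeasurable g m →
      ∫⁻ s, ‖g s‖ₑ ^ 2 ∂ν n = ∫⁻ s, ‖q n s * g s‖ₑ ^ 2 ∂m := by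
    intro n g hg
    rw [hν, lintegral_withDensity_eq_lintegral_mul₀ (hr n).coe_nnreal_ennreal.aemeasurable
      (hg.enorm.pow_const 2)]
    refine lintegral_congr fun s => ?_
    rw [Pi.mul_apply, enorm_mul, mul_pow, hqe]
  have hcint : ∀ f, ∫⁻ s, ∑' n, ‖c f n s‖ₑ ^ 2 ∂m = ‖f‖ₑ ^ 2 := by
    intro f
    rw [lintegral_tsum fun n => ((hcm f n).enorm.pow_const 2).aemeasurable]
    have h1 : ∀ n, ∫⁻ s, ‖c f n s‖ₑ ^ 2 ∂m = ‖W f n‖ₑ ^ 2 := by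
      intro n
      rw [← Lp.lintegral_enorm_sq, hdens n _ (Lp.stronglyMeasurable _).measurable.aemeasurable]
    simp only [h1]
    rw [lp.tsum_enorm_sq, ← ofReal_norm, W.norm_map, ofReal_norm]
  have hcfin : ∀ f, ∀ᵐ s ∂m, ∑' n, ‖c f n s‖ₑ ^ 2 ≠ ∞ := by
    intro f
    have h1 : Measurable fun s => ∑' n, ‖c f n s‖ₑ ^ 2 :=
      Measurable.tsum fun n => (hcm f n).enorm.pow_const 2
    filter_upwards [ae_lt_top h1 (by rw [hcint]; simp)] with s hs
    exact hs.ne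
  have hT : ∀ f, ∀ᵐ s ∂m, ∀ n, ⟪coordVec r n s, ofCoords r (c f) s⟫_ℂ = c f n s := by
    intro f
    filter_upwards [hcfin f] with s hs
    exact inner_ofCoords r hs fun n => hc0 f n s
  have hnorm : ∀ f, ∫⁻ s, ‖ofCoords r (c f) s‖ₑ ^ 2 ∂m = ‖f‖ₑ ^ 2 := by
    intro f
    rw [← hcint]
    refine lintegral_congr_ae ?_
    filter_upwards [hT f] with s hs
    rw [← tsum_inner_coordVec]
    simp only [hs]
  have hsurj : ∀ a : ∀ s, Fibre r s, (∀ n, AEMeasurable (fun s => ⟪coordVec r n s, a s⟫_ℂ) m) →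
      ∫⁻ s, ‖a s‖ₑ ^ 2 ∂m < ∞ → ∃ f, ∀ᵐ s ∂m, ofCoords r (c f) s = a s := by
    intro a ham hafin
    set b : ℕ → ℝ≥0 → ℂ := fun n s => ⟪coordVec r n s, a s⟫_ℂ with hb
    have hb0 : ∀ n s, r n s = 0 → b n s = 0 := fun n s h => inner_coordVec_of_eq r h _
    -- Where the density is zero the inverse is zero by convention, consistently with `b n s = 0`
    -- there.
    set g : ℕ → ℝ≥0 → ℂ := fun n s => (q n s)⁻¹ * b n s with hg
    have hgm : ∀ n, AEMeasurable (g n) m := fun n => (hqm n).inv.aemeasurable.mul (ham n)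
    have hqg : ∀ n s, q n s * g n s = b n s := by
      intro n s
      by_cases hn : r n s = 0
      · simp [hg, hb0 n s hn]
      · have := (hq0 n s).not.2 hn
        simp only [hg]
        field_simp
    have hgint : ∑' n, ∫⁻ s, ‖g n s‖ₑ ^ 2 ∂ν n < ∞ := by
      have h1 : ∀ n, ∫⁻ s, ‖g n s‖ₑ ^ 2 ∂ν n = ∫⁻ s, ‖b n s‖ₑ ^ 2 ∂m := by
        intro n
        rw [hdens n _ (hgm n)]
        simp only [hqg]
      simp only [h1]
      rw [← lintegral_tsum fun n => (ham n).enorm.pow_const 2]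
      simp only [tsum_inner_coordVec]
      exact hafin
    have hgL : ∀ n, MemLp (g n) 2 (ν n) := by
      intro n
      refine ⟨((hgm n).mono_ac (hac n)).aestronglyMeasurable, ?_⟩
      rw [eLpNorm_lt_top_iff_lintegral_rpow_enorm_lt_top (by norm_num) (by norm_num)]
      simp only [ENNReal.toReal_ofNat, ENNReal.rpow_ofNat]
      exact (ENNReal.le_tsum n).trans_lt hgint
    have hw : Memℓp (fun n => (hgL n).toLp (g n)) 2 := by
      refine memℓp_two_of_tsum_enorm_sq ?_
      have h1 : ∀ n, ‖(hgL n).toLp (g n)‖ₑ ^ 2 = ∫⁻ s, ‖g n s‖ₑ ^ 2 ∂ν n := by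
        intro n
        rw [← Lp.lintegral_enorm_sq]
        refine lintegral_congr_ae ?_
        filter_upwards [(hgL n).coeFn_toLp] with s hs
        rw [hs]
      simp only [h1]
      exact hgint.ne
    refine ⟨W.symm ⟨_, hw⟩, ?_⟩
    have h1 := hae (p := fun n s => W (W.symm ⟨_, hw⟩) n s = g n s) fun n => by
      rw [LinearIsometryEquiv.apply_symm_apply]
      exact (hgL n).coeFn_toLp
    filter_upwards [h1, hT (W.symm ⟨_, hw⟩)] with s h2 h3
    refine ext_inner_coordVec r fun n => ?_
    rw [h3]
    by_cases hn : r n s = 0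
    · rw [hc0 _ n s hn]
      exact (hb0 n s hn).symm
    · simp only [hc]
      rw [h2 n hn, hqg]
  refine ⟨field m hr, fun f => ofCoords r (c f), ?_, ?_, ?_, hnorm, ?_, ?_⟩
  · intro f
    refine ⟨fun n => ?_, ?_⟩
    · refine (hcm f n).aemeasurable.congr ?_
      filter_upwards [hT f] with s hs
      exact (hs n).symm
    · change ∫⁻ s, ‖ofCoords r (c f) s‖ₑ ^ 2 ∂m < ∞
      rw [hnorm]
      simp
  · intro f g
    have h1 := hae (p := fun n s => W (f + g) n s = W f n s + W g n s) fun n => by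
      rw [map_add]
      exact Lp.coeFn_add _ _
    change ∀ᵐ s ∂m, ofCoords r (c (f + g)) s = ofCoords r (c f) s + ofCoords r (c g) s
    filter_upwards [hT f, hT g, hT (f + g), h1] with s h2 h3 h4 h5
    refine ext_inner_coordVec r fun n => ?_
    rw [inner_add_right, h2, h3, h4]
    by_cases hn : r n s = 0
    · simp [hc0 _ n s hn]
    · simp only [hc, h5 n hn]
      ring
  · intro z f
    have h1 := hae (p := fun n s => W (z • f) n s = z * W f n s) fun n => by
      rw [map_smul]
      exact Lp.coeFn_smul _ _
    change ∀ᵐ s ∂m, ofCoords r (c (z • f)) s = z • ofCoords r (c f) s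
    filter_upwards [hT f, hT (z • f), h1] with s h2 h3 h4
    refine ext_inner_coordVec r fun n => ?_
    rw [inner_smul_right, h2, h3]
    by_cases hn : r n s = 0
    · simp [hc0 _ n s hn]
    · simp only [hc, h4 n hn]
      ring
  · exact fun a ha => hsurj a ha.1 ha.2
  · intro f g φ hφ
    have h1 := hae hφ
    change ∀ᵐ s ∂m, ofCoords r (c g) s = φ s • ofCoords r (c f) s
    filter_upwards [h1, hT f, hT g] with s h2 h3 h4
    refine ext_inner_coordVec r fun n => ?_
    rw [inner_smul_right, h3, h4]
    by_cases hn : r n s = 0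
    · simp [hc0 _ n s hn]
    · simp only [hc, h2 n hn]
      ring

/-- An operator `L` such that `L + 1` has an inverse which is a positive contraction has a spectral
Fourier transform. -/
theorem nonempty_spectralFourierTransform {H : Type*} [NormedAddCommGroup H]
    [InnerProductSpace ℂ H] [CompleteSpace H] {L : H →ₗ.[ℂ] H} (R : H →L[ℂ] H)
    (hpos : R.IsPositive) (hnorm : ‖R‖ ≤ 1) (hdom : ∀ f, f ∈ L.domain ↔ ∃ g, R g = f)
    (hL : ∀ (f : L.domain) (g : H), R g = f → L f = g - f) (x : ℕ → H)
    (hx : Dense (Submodule.span ℂ (Set.range x) : Set H)) :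
    Nonempty (SpectralFourierTransform L) := by
  have hinj : ∀ f, R f = 0 → f = 0 := by
    intro f hf
    have := hL 0 f (by simpa using hf)
    simpa using this.symm
  obtain ⟨ν, hν, W, hW⟩ := exists_isHilbertSum_of_isPositive R hpos hnorm hinj x hx
  obtain ⟨D, T, hsq, hadd, hsmul, hnormT, hsurj, hmul⟩ := exists_directIntegral ν W
  have hTR : ∀ g, ∀ᵐ s ∂D.m, T (R g) s = ((1 : ℂ) + (s : ℝ))⁻¹ • T g s :=
    fun g => hmul g (R g) _ (hW g)
  have hsub : ∀ f g, ∀ᵐ s ∂D.m, T (f - g) s = T f s - T g s := by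
    intro f g
    filter_upwards [hadd (f - g) g] with s hs
    rw [sub_add_cancel] at hs
    rw [hs, add_sub_cancel_right]
  have hne : ∀ s : ℝ≥0, (1 : ℂ) + (s : ℝ) ≠ 0 := by
    intro s h
    have := congrArg Complex.re h
    simp only [Complex.add_re, Complex.one_re, Complex.ofReal_re, Complex.zero_re] at this
    have := s.2
    linarith
  have hTeq : ∀ f g, (∀ᵐ s ∂D.m, T f s = T g s) → f = g := by
    intro f g h
    have h1 := hnormT (f - g)
    rw [lintegral_congr_ae (g := fun _ => 0)] at h1
    · simpa [sub_eq_zero] using h1.symm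
    · filter_upwards [h, hsub f g] with s h2 h3
      simp [h3, h2]
  have hLT : ∀ f g, R g = f → ∀ᵐ s : ℝ≥0 ∂D.m, T (g - f) s = ((s : ℝ) : ℂ) • T f s := by
    rintro _ g rfl
    filter_upwards [hTR g, hsub g (R g)] with s h1 h2
    have h3 : ((s : ℝ) : ℂ) * ((1 : ℂ) + (s : ℝ))⁻¹ = 1 - ((1 : ℂ) + (s : ℝ))⁻¹ := by
      field_simp [hne s]
      ring
    rw [h2, h1, smul_smul, h3, sub_smul, one_smul]
  refine ⟨⟨D, T, hsq, hadd, hsmul, hnormT, hsurj, fun f => ⟨fun hf => ?_, fun hf => ?_⟩, ?_⟩⟩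
  · obtain ⟨g, hg⟩ := (hdom f).1 hf
    exact (hsq (g - f)).congr (hLT f g hg)
  · obtain ⟨g, hg⟩ := hsurj _ ((hsq f).add hf)
    refine (hdom f).2 ⟨g, hTeq _ _ ?_⟩
    filter_upwards [hTR g, hg] with s h1 h2
    rw [h1, h2]
    have h3 : T f s + ((s : ℝ) : ℂ) • T f s = ((1 : ℂ) + (s : ℝ)) • T f s := by
      rw [add_smul, one_smul]
    rw [h3, inv_smul_smul₀ (hne s)]
  · intro f
    obtain ⟨g, hg⟩ := (hdom f).1 f.2
    rw [hL f g hg]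
    exact hLT f g hg

end

/-! ### The graph Laplacian and its resolvent. -/

noncomputable section

namespace GraphLaplacian

variable {V : Type*} (G : SimpleGraph V) [G.LocallyFinite]

/-- The pointwise Laplacian as a linear map. -/
def lapLin : (V → ℂ) →ₗ[ℂ] (V → ℂ) where
  toFun := lapFun G
  map_add' := lapFun_add G
  map_smul' := lapFun_smul G

/-- Maximum principle. Square-summability forces `|g|` to attain a maximum at some `v`, where the
equation reads `(1 + deg v) g v = ∑ g u`; so `(1 + deg v) |g v| ≤ deg v |g v|` and `g v = 0`. Only
finiteness of each degree matters. -/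
theorem eq_zero_of_add_lapFun_eq_zero (g : GraphL2 V) (h : ∀ v, g v + lapFun G g v = 0) :
    g = 0 := by
  by_contra hg
  obtain ⟨v₀, hv₀⟩ : ∃ v, g v ≠ 0 := by
    by_contra! hcon
    exact hg (lp.ext (funext hcon))
  have hsum : Summable fun v => ‖g v‖ ^ 2 := by
    simpa using (lp.memℓp g).summable (by norm_num)
  have hfin : {v | ‖g v₀‖ ^ 2 ≤ ‖g v‖ ^ 2}.Finite := by
    have := hsum.tendsto_cofinite_zero.eventually_lt_const (v := 0) (u := ‖g v₀‖ ^ 2)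
      (by positivity)
    simpa [Filter.eventually_cofinite] using this
  obtain ⟨v, hv, hmax⟩ := Set.exists_max_image _ (fun v => ‖g v‖ ^ 2) hfin
    ⟨v₀, le_refl (‖g v₀‖ ^ 2)⟩
  have hle : ∀ u, ‖g u‖ ≤ ‖g v‖ := by
    intro u
    have h0 : ‖g u‖ ^ 2 ≤ ‖g v‖ ^ 2 := by
      rcases le_total (‖g v₀‖ ^ 2) (‖g u‖ ^ 2) with h1 | h1
      · exact hmax u h1
      · exact h1.trans hv
    exact (sq_le_sq₀ (norm_nonneg _) (norm_nonneg _)).1 h0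
  have h1 := h v
  rw [lapFun, Finset.sum_sub_distrib, Finset.sum_const, nsmul_eq_mul] at h1
  have h2 : ((1 + (G.neighborFinset v).card : ℝ) : ℂ) * g v = ∑ u ∈ G.neighborFinset v, g u := by
    push_cast
    linear_combination h1
  have h3 : (1 + (G.neighborFinset v).card : ℝ) * ‖g v‖ ≤ (G.neighborFinset v).card * ‖g v‖ := by
    calc _ = ‖((1 + (G.neighborFinset v).card : ℝ) : ℂ) * g v‖ := by
          rw [norm_mul, Complex.norm_real, Real.norm_of_nonneg (by positivity)]
      _ = ‖∑ u ∈ G.neighborFinset v, g u‖ := by rw [h2]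
      _ ≤ ∑ u ∈ G.neighborFinset v, ‖g v‖ := norm_sum_le_of_le _ fun u _ => hle u
      _ = _ := by rw [Finset.sum_const, nsmul_eq_mul]
  have h4 := norm_pos_iff.2 hv₀
  have h5 := hle v₀
  linarith

/-- The lower bound is antisymmetric in `a` and `b`, so it cancels when summed over both
orientations of an edge. -/
theorem half_sub_le_re_conj_mul_sub (a b : ℂ) :
    (‖a‖ ^ 2 - ‖b‖ ^ 2) / 2 ≤ ((starRingEnd ℂ) a * (a - b)).re := by
  have h1 : ((starRingEnd ℂ) a * (a - b)).re = ‖a‖ ^ 2 - ((starRingEnd ℂ) a * b).re := by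
    rw [mul_sub, Complex.sub_re, Complex.conj_mul', ← Complex.ofReal_pow, Complex.ofReal_re]
  have h2 : ((starRingEnd ℂ) a * b).re ≤ ‖a‖ * ‖b‖ := by
    refine (Complex.re_le_norm _).trans ?_
    simp
  nlinarith [sq_nonneg (‖a‖ - ‖b‖)]

/-- Edges inside the support cancel by antisymmetry; an edge leaving the support contributes `|f v|²
/ 2`. -/
theorem re_sum_conj_mul_lapFun_nonneg (f : V →₀ ℂ) :
    0 ≤ (∑ v ∈ f.support, (starRingEnd ℂ) (f v) * lapFun G f v).re := by
  classical
  set S := f.support with hS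
  have h1 : ∑ v ∈ S, ∑ u ∈ G.neighborFinset v, (‖f v‖ ^ 2 - ‖f u‖ ^ 2) / 2 ≤
      (∑ v ∈ S, (starRingEnd ℂ) (f v) * lapFun G f v).re := by
    simp only [lapFun, Finset.mul_sum, Complex.re_sum]
    exact Finset.sum_le_sum fun v _ => Finset.sum_le_sum fun u _ =>
      half_sub_le_re_conj_mul_sub _ _
  refine le_trans ?_ h1
  have h2 : ∑ v ∈ S, ∑ u ∈ S, (if G.Adj v u then (‖f v‖ ^ 2 - ‖f u‖ ^ 2) / 2 else 0) = 0 := by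
    have h3 : ∑ v ∈ S, ∑ u ∈ S, (if G.Adj v u then (‖f v‖ ^ 2 - ‖f u‖ ^ 2) / 2 else 0) =
        -∑ v ∈ S, ∑ u ∈ S, (if G.Adj v u then (‖f v‖ ^ 2 - ‖f u‖ ^ 2) / 2 else 0) := by
      conv_lhs => rw [Finset.sum_comm]
      simp only [← Finset.sum_neg_distrib]
      refine Finset.sum_congr rfl fun v _ => Finset.sum_congr rfl fun u _ => ?_
      rw [G.adj_comm u v]
      split_ifs <;> ring
    linarith
  rw [← h2]
  refine Finset.sum_le_sum fun v _ => ?_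
  rw [← Finset.sum_filter]
  have h4 : S.filter (fun u => G.Adj v u) ⊆ G.neighborFinset v := by
    intro u hu
    simpa using (Finset.mem_filter.1 hu).2
  refine Finset.sum_le_sum_of_subset_of_nonneg h4 fun u hu hu' => ?_
  have h5 : f u = 0 := by
    by_contra hne
    refine hu' (Finset.mem_filter.2 ⟨by simpa [hS] using hne, by simpa using hu⟩)
  rw [h5, norm_zero, zero_pow two_ne_zero, sub_zero]
  positivity

open Classical in
/-- The unit mass at a vertex. -/
def delta (v : V) : GraphL2 V := lp.single 2 v 1

open Classical in
theorem delta_apply (v w : V) : delta v w = if w = v then 1 else 0 := by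
  simp only [delta, lp.single_apply, Pi.single_apply]

theorem inner_delta (v : V) (g : GraphL2 V) : ⟪delta v, g⟫_ℂ = g v := by
  classical
  rw [delta, lp.inner_single_left]
  simp

/-- The Laplacian of the unit mass at a vertex. -/
def lapDelta (v : V) : GraphL2 V :=
  ((G.neighborFinset v).card : ℂ) • delta v - ∑ u ∈ G.neighborFinset v, delta u

theorem lapDelta_apply (v : V) : (lapDelta G v : V → ℂ) = lapFun G (delta v) := by
  classical
  funext w
  rw [lapDelta, lp.coeFn_sub, lp.coeFn_smul, lp.coeFn_sum]
  simp only [Pi.sub_apply, Pi.smul_apply, Finset.sum_apply, delta_apply, smul_eq_mul, lapFun,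
    Finset.sum_sub_distrib, Finset.sum_const, nsmul_eq_mul, Finset.sum_ite_eq,
    Finset.sum_ite_eq', SimpleGraph.mem_neighborFinset]
  by_cases h : w = v
  · subst h; rfl
  · simp [h, G.adj_comm v w]

/-- The pointwise Laplacian of every `ℓ²` function is a pairing with a finitely supported vector,
with no domain condition on `g`. -/
theorem inner_lapDelta (v : V) (g : GraphL2 V) : ⟪lapDelta G v, g⟫_ℂ = lapFun G g v := by
  rw [lapDelta, inner_sub_left, inner_smul_left, sum_inner, lapFun, Finset.sum_sub_distrib]
  simp [inner_delta]

/-- The inclusion of the finitely supported functions. -/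
def incl : (V →₀ ℂ) →ₗ[ℂ] GraphL2 V := Finsupp.linearCombination ℂ delta

/-- The operator `1 + L` on finitely supported functions. -/
def oneAddLap : (V →₀ ℂ) →ₗ[ℂ] GraphL2 V :=
  Finsupp.linearCombination ℂ fun v => delta v + lapDelta G v

theorem inner_incl (f : V →₀ ℂ) (g : GraphL2 V) :
    ⟪incl f, g⟫_ℂ = ∑ v ∈ f.support, (starRingEnd ℂ) (f v) * g v := by
  rw [incl, Finsupp.linearCombination_apply, Finsupp.sum, sum_inner]
  simp only [inner_smul_left, inner_delta]

theorem inner_oneAddLap (f : V →₀ ℂ) (g : GraphL2 V) :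
    ⟪oneAddLap G f, g⟫_ℂ =
      ∑ v ∈ f.support, (starRingEnd ℂ) (f v) * (g v + lapFun G g v) := by
  rw [oneAddLap, Finsupp.linearCombination_apply, Finsupp.sum, sum_inner]
  simp only [inner_smul_left, inner_add_left, inner_delta, inner_lapDelta]

theorem incl_apply (f : V →₀ ℂ) : (incl f : V → ℂ) = f := by
  classical
  funext w
  rw [incl, Finsupp.linearCombination_apply, Finsupp.sum, lp.coeFn_sum, Finset.sum_apply]
  simp only [lp.coeFn_smul, Pi.smul_apply, delta_apply, smul_eq_mul, mul_ite, mul_one, mul_zero,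
    Finset.sum_ite_eq]
  by_cases h : f w = 0 <;> simp [h]

theorem oneAddLap_apply (f : V →₀ ℂ) (v : V) :
    oneAddLap G f v = incl f v + lapFun G (incl f) v := by
  have h1 : lapFun G (incl f) = ∑ v ∈ f.support, f v • lapFun G (delta v) := by
    change lapLin G (incl f) = ∑ v ∈ f.support, f v • lapLin G (delta v)
    rw [incl, Finsupp.linearCombination_apply, Finsupp.sum, lp.coeFn_sum, map_sum]
    simp only [lp.coeFn_smul, map_smul]
  rw [h1, oneAddLap, incl, Finsupp.linearCombination_apply, Finsupp.linearCombination_apply,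
    Finsupp.sum, Finsupp.sum, lp.coeFn_sum, lp.coeFn_sum]
  simp only [← lapDelta_apply, Finset.sum_apply, ← Finset.sum_add_distrib]
  refine Finset.sum_congr rfl fun u _ => ?_
  rw [smul_add]
  rfl

theorem inner_oneAddLap_incl (f k : V →₀ ℂ) :
    ⟪oneAddLap G f, incl k⟫_ℂ = ⟪incl f, oneAddLap G k⟫_ℂ := by
  rw [inner_oneAddLap, inner_incl]
  simp only [oneAddLap_apply]

theorem norm_sq_incl_le (f : V →₀ ℂ) :
    ‖incl f‖ ^ 2 ≤ (⟪oneAddLap G f, incl f⟫_ℂ).re := by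
  have h1 : ‖incl f‖ ^ 2 = (⟪incl f, incl f⟫_ℂ).re := norm_sq_eq_re_inner (𝕜 := ℂ) _
  rw [h1, inner_incl, inner_oneAddLap]
  simp only [mul_add, Finset.sum_add_distrib, Complex.add_re]
  rw [incl_apply]
  have := re_sum_conj_mul_lapFun_nonneg G f
  linarith

/-- Cauchy–Schwarz turns coercivity into the bound by which the inverse of `1 + L` extends as a
contraction. -/
theorem norm_incl_le (f : V →₀ ℂ) : ‖incl f‖ ≤ 1 * ‖oneAddLap G f‖ := by
  have h1 := norm_sq_incl_le G f
  have h2 := (Complex.re_le_norm _).trans (norm_inner_le_norm (𝕜 := ℂ) (oneAddLap G f) (incl f))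
  rcases (norm_nonneg (incl f)).eq_or_lt with h | h
  · rw [← h]; positivity
  · rw [one_mul]
    nlinarith

/-- A vector orthogonal to every `(1 + L) δ_v` solves `g + Lg = 0` pointwise, so the maximum
principle applies. -/
theorem denseRange_oneAddLap : DenseRange (oneAddLap G) := by
  have h1 : (LinearMap.range (oneAddLap G))ᗮ = ⊥ := by
    rw [Submodule.eq_bot_iff]
    intro g hg
    refine eq_zero_of_add_lapFun_eq_zero G g fun v => ?_
    have := hg _ ⟨Finsupp.single v 1, rfl⟩
    rwa [oneAddLap, Finsupp.linearCombination_single, one_smul, inner_add_left, inner_delta,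
      inner_lapDelta] at this
  have h2 := Submodule.topologicalClosure_eq_top_iff.2 h1
  exact Submodule.dense_iff_topologicalClosure_eq_top.2 h2

/-- The resolvent `(1 + L)⁻¹`. -/
def resolvent : GraphL2 V →L[ℂ] GraphL2 V := incl.extendOfNorm (oneAddLap G)

theorem resolvent_oneAddLap (f : V →₀ ℂ) : resolvent G (oneAddLap G f) = incl f :=
  LinearMap.extendOfNorm_eq (denseRange_oneAddLap G) ⟨1, norm_incl_le G⟩ f

theorem norm_resolvent_le : ‖resolvent G‖ ≤ 1 :=
  LinearMap.opNorm_extendOfNorm_le (denseRange_oneAddLap G) zero_le_one (norm_incl_le G)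

theorem inner_resolvent (a b : GraphL2 V) : ⟪resolvent G a, b⟫_ℂ = ⟪a, resolvent G b⟫_ℂ := by
  refine (denseRange_oneAddLap G).induction_on₂ (p := fun a b =>
    ⟪resolvent G a, b⟫_ℂ = ⟪a, resolvent G b⟫_ℂ) ?_ ?_ a b
  · exact isClosed_eq (by fun_prop) (by fun_prop)
  · intro f k
    rw [resolvent_oneAddLap, resolvent_oneAddLap, inner_oneAddLap_incl]

theorem isPositive_resolvent : (resolvent G).IsPositive := by
  refine ⟨fun a b => inner_resolvent G a b, fun a => ?_⟩
  refine (denseRange_oneAddLap G).induction_on (p := fun a =>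
    0 ≤ (resolvent G).reApplyInnerSelf a) a ?_ ?_
  · exact isClosed_le continuous_const (resolvent G).reApplyInnerSelf_continuous
  · intro f
    rw [ContinuousLinearMap.reApplyInnerSelf_apply, resolvent_oneAddLap, ← inner_oneAddLap_incl]
    exact (sq_nonneg _).trans (norm_sq_incl_le G f)

/-- Symmetry of the resolvent, tested against `(1 + L) δ_v`, evaluates the equation at `v` for
arbitrary `a`, without approximating `a`. -/
theorem resolvent_apply_add (a : GraphL2 V) (v : V) :
    resolvent G a v + lapFun G (resolvent G a) v = a v := by
  have h := inner_resolvent G (oneAddLap G (Finsupp.single v 1)) a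
  rw [resolvent_oneAddLap, incl, oneAddLap, Finsupp.linearCombination_single,
    Finsupp.linearCombination_single, one_smul, one_smul, inner_add_left, inner_delta, inner_delta,
    inner_lapDelta] at h
  exact h.symm

theorem lapFun_resolvent (a : GraphL2 V) :
    lapFun G (resolvent G a) = ((a - resolvent G a : GraphL2 V) : V → ℂ) := by
  funext v
  rw [lp.coeFn_sub, Pi.sub_apply, ← resolvent_apply_add G a v, add_sub_cancel_left]

/-- For `f` in the natural domain, `R (f + Lf) - f` is an `ℓ²` solution of `u + Lu = 0`, hence zero.
The maximal domain is thus no larger than the range of the resolvent. -/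
theorem mem_domain_iff (f : GraphL2 V) :
    f ∈ (laplacian G).domain ↔ ∃ g, resolvent G g = f := by
  constructor
  · intro hf
    set Lf : GraphL2 V := ⟨lapFun G f, hf⟩ with hLf
    refine ⟨f + Lf, ?_⟩
    rw [← sub_eq_zero]
    refine eq_zero_of_add_lapFun_eq_zero G _ fun v => ?_
    have h1 : lapFun G ((resolvent G (f + Lf) - f : GraphL2 V) : V → ℂ) =
        lapFun G (resolvent G (f + Lf)) - lapFun G f := by
      rw [lp.coeFn_sub]
      exact map_sub (lapLin G) _ _
    have h2 := resolvent_apply_add G (f + Lf) v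
    have h3 : (f + Lf) v = f v + lapFun G f v := rfl
    rw [h1, lp.coeFn_sub, Pi.sub_apply, Pi.sub_apply]
    rw [h3] at h2
    linear_combination h2
  · rintro ⟨g, rfl⟩
    change Memℓp (lapFun G (resolvent G g)) 2
    rw [lapFun_resolvent]
    exact lp.memℓp _

theorem laplacian_apply_eq (f : (laplacian G).domain) (g : GraphL2 V) (h : resolvent G g = f) :
    laplacian G f = g - f := by
  apply lp.ext
  change lapFun G (f : GraphL2 V) = _
  rw [← h, lapFun_resolvent]

theorem exists_seq_dense_span [Countable V] [Nonempty V] :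
    ∃ x : ℕ → GraphL2 V, Dense (Submodule.span ℂ (Set.range x) : Set (GraphL2 V)) := by
  classical
  obtain ⟨enum, henum⟩ := exists_surjective_nat V
  refine ⟨fun n => delta (enum n), fun a => ?_⟩
  have h := lp.hasSum_single (p := 2) (by norm_num) a
  refine mem_closure_of_tendsto h (Filter.Eventually.of_forall fun S => ?_)
  refine Submodule.sum_mem _ fun v _ => ?_
  obtain ⟨n, rfl⟩ := henum v
  have h1 : lp.single 2 (enum n) (a (enum n)) = a (enum n) • delta (enum n) := by
    rw [delta, ← lp.single_smul, smul_eq_mul, mul_one]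
  rw [h1]
  exact Submodule.smul_mem _ _ (Submodule.subset_span ⟨n, rfl⟩)

theorem nonempty_spectralFourierTransform_laplacian [Countable V] [Nonempty V] :
    Nonempty (SpectralFourierTransform (laplacian G)) := by
  obtain ⟨x, hx⟩ := exists_seq_dense_span (V := V)
  exact nonempty_spectralFourierTransform (resolvent G) (isPositive_resolvent G)
    (norm_resolvent_le G) (mem_domain_iff G) (laplacian_apply_eq G) x hx

end GraphLaplacian

end

theorem theorem4p1 {V : Type*} [Countable V] (G : SimpleGraph V) [G.LocallyFinite]
    (hG : G.Connected) :
    Nonempty (SpectralFourierTransform (laplacian G)) ∧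
    ∀ (F : SpectralFourierTransform (laplacian G)) (ω : ℝ), 0 ≤ ω →
      ∀ h : ℂ → ℂ, IsEntireOfExpType ω h → Integrable (fun t : ℝ => h (t : ℂ)) →
        ∀ f : GraphL2 V,
          Integrable (fun t : ℝ => h (t : ℂ) • F.expI t f) ∧
          (∫ t : ℝ, h (t : ℂ) • F.expI t f) ∈ F.PW ω := by
  have := hG.nonempty
  exact ⟨GraphLaplacian.nonempty_spectralFourierTransform_laplacian G,
    fun F _ hω _ hh hi f => ⟨F.integrable_smul_expI hi f, F.integral_smul_expI_mem_PW hω hh hi f⟩⟩
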